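/- Let $M$ be a closed (compact, connected, boundaryless) smooth Riemannian manifold with universal covering $\tilde M$, and suppose that $\pi_1(M)$ is unstretchable. Here a group $G$ is \emph{unstretchable} if it is finitely generated and, with respect to the word metric of a finite generating set, for every automorphism $\phi$ of $G$, every integer $N>0$ and every finite set $A_0\subset G$, the sequence $A_{k+1}=U_N(\phi(A_k))$, where $U_N$ denotes the $N$-neighbourhood, grows at most polynomially in diameter: there are $C,d$ with $\operatorname{diam}(A_k)\le C(k+1)^d$ for all $k\ge 0$. Let $f:M\to M$ be a $C^1$ diffeomorphism and let $W$ be a one-dimensional (continuous) foliation of $M$ with $C^1$ leaves that is invariant, i.e. $f(W(x))=W(f(x))$ for every $x\in M$, where $W(x)$ is the leaf through $x$, and quasi-isometric, i.e. there is a constant $Q>1$ such that $d_{\tilde W}(x,y)<Q\,d_{\tilde M}(x,y)+Q$ for all $x,y$ on the same leaf of the lifted foliation $\tilde W$ of $\tilde M$, where $d_{\tilde M}$ is the distance of the lifted Riemannian metric and $d_{\tilde W}$ the distance along the leaves. Let $R$ be the set of points $x\in M$ at which the leafwise Lyapunov exponent \[ \lambda^W(x)=\lim_{|n|\to\infty}\frac1n\log\bigl\|Tf^n|_{TW(x)}\bigr\|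 \qquad (n\in\mathbb Z) \] exists as a real number, and let $R'=\{x\in R:\lambda^W(x)\neq 0\}$. Then $R'$ intersects each leaf of $W$ in a set of one-dimensional Lebesgue measure zero. Moreover, if $W$ is absolutely continuous, in the sense that every Borel subset of $M$ that intersects each leaf of $W$ in a set of one-dimensional Lebesgue measure zero has Lebesgue measure zero in $M$, then $R'$ has Lebesgue measure zero as a subset of $M$. -/

import Mathlib

open Set Filter MeasureTheory Manifold Bundle
open scoped Topology ENNReal NNReal ContDiff

noncomputable section

/-! ### Word metrics and unstretchable groups -/

/-- Length of `g` as a word in the elements of `S` and their inverses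
(meaningful when `S` generates the group). -/
def wordLength {G : Type*} [Group G] (S : Finset G) (g : G) : ℕ :=
  sInf {n : ℕ | ∃ l : List G, l.length = n ∧ (∀ s ∈ l, s ∈ S ∨ s⁻¹ ∈ S) ∧ l.prod = g}

/-- The word distance `|x⁻¹ y|`. -/
def wordDist {G : Type*} [Group G] (S : Finset G) (x y : G) : ℕ :=
  wordLength S (x⁻¹ * y)

/-- The `N`-neighbourhood `U_N(A)` of a subset `A` of a group, in the word metric. -/
def wordNhd {G : Type*} [Group G] (S : Finset G) (N : ℕ) (A : Set G) : Set G :=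
  {y | ∃ x ∈ A, wordDist S x y ≤ N}

/-- The sequence `A_0, A_1, …` with `A_{k+1} = U_N(φ(A_k))`. -/
def stretchSeq {G : Type*} [Group G] (S : Finset G) (φ : G ≃* G) (N : ℕ) (A₀ : Set G) :
    ℕ → Set G
  | 0 => A₀
  | k + 1 => wordNhd S N (φ '' stretchSeq S φ N A₀ k)

/-- A finitely generated group is unstretchable if, for the word metric of a finite generating
set, for every automorphism `φ`, every `N > 0` and every finite starting set `A_0`, the diameter
of the sets `A_{k+1} = U_N(φ(A_k))` grows at most polynomially in `k`. -/
def IsUnstretchable (G : Type*) [Group G] : Prop :=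
  ∃ S : Finset G, Subgroup.closure (S : Set G) = ⊤ ∧
    ∀ (φ : G ≃* G) (N : ℕ), 0 < N → ∀ A₀ : Set G, A₀.Finite →
      ∃ C d : ℕ, ∀ k : ℕ, ∀ x ∈ stretchSeq S φ N A₀ k, ∀ y ∈ stretchSeq S φ N A₀ k,
        wordDist S x y ≤ C * (k + 1) ^ d

/-! ### One-dimensional foliations with `C¹` leaves -/

/-- Let `A` be a family of foliation charts with values in `ℝ × ℝᵏ`, the plaques being the level
sets of the second coordinate. A map `γ` is leafwise on `s` if it is continuous on `s` and, locally,
stays in a single plaque. -/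
def IsLeafwise {k : ℕ} {M : Type*} [TopologicalSpace M]
    (A : Set (OpenPartialHomeomorph M (ℝ × EuclideanSpace ℝ (Fin k))))
    (γ : ℝ → M) (s : Set ℝ) : Prop :=
  ContinuousOn γ s ∧
    ∀ t ∈ s, ∀ φ ∈ A, γ t ∈ φ.source → ∀ᶠ r in 𝓝[s] t, (φ (γ r)).2 = (φ (γ t)).2

/-- `γ` is a regular `C¹` curve on the open set `s` that is contained in a leaf. -/
def IsRegularLeafCurve {k : ℕ} {M : Type*} [TopologicalSpace M]
    [ChartedSpace (EuclideanSpace ℝ (Fin (k + 1))) M]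
    (A : Set (OpenPartialHomeomorph M (ℝ × EuclideanSpace ℝ (Fin k))))
    (γ : ℝ → M) (s : Set ℝ) : Prop :=
  IsLeafwise A γ s ∧ ContMDiffOn 𝓘(ℝ, ℝ) (𝓡 (k + 1)) 1 γ s ∧
    ∀ t ∈ s, mfderiv 𝓘(ℝ, ℝ) (𝓡 (k + 1)) γ t 1 ≠ 0

/-- A one-dimensional (continuous) foliation with `C¹` leaves of a manifold `M` of dimension
`k + 1`, given by a foliated atlas: foliation charts are homeomorphisms from open subsets of `M`
to open subsets of `ℝ × ℝᵏ`, the changes of charts have locally the form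
`(t, y) ↦ (h₁(t, y), h₂(y))`, and every plaque is a `C¹` curve. -/
structure LineFoliation (k : ℕ) (M : Type*) [TopologicalSpace M]
    [ChartedSpace (EuclideanSpace ℝ (Fin (k + 1))) M] where
  atlas : Set (OpenPartialHomeomorph M (ℝ × EuclideanSpace ℝ (Fin k)))
  cover : ∀ p : M, ∃ φ ∈ atlas, p ∈ φ.source
  compatible : ∀ φ ∈ atlas, ∀ ψ ∈ atlas, ∀ p ∈ φ.source ∩ ψ.source,
    ∃ V ∈ 𝓝 p, ∀ q ∈ V, ∀ q' ∈ V, (φ q).2 = (φ q').2 → (ψ q).2 = (ψ q').2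
  leaves_C1 : ∀ p : M, ∃ (γ : ℝ → M) (ε : ℝ), 0 < ε ∧ γ 0 = p ∧
    IsRegularLeafCurve atlas γ (Ioo (-ε) ε)

namespace LineFoliation

variable {k : ℕ} {M : Type*} [TopologicalSpace M]
  [ChartedSpace (EuclideanSpace ℝ (Fin (k + 1))) M]

/-- The leaf of `W` through `x`: all points that can be reached from `x` by a leafwise path. -/
def leaf (W : LineFoliation k M) (x : M) : Set M :=
  {y | ∃ γ : ℝ → M, IsLeafwise W.atlas γ (Icc 0 1) ∧ γ 0 = x ∧ γ 1 = y}

/-- `f(W) = W`: the map `f` sends each leaf of `W` onto a leaf of `W`. -/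
def IsInvariant (W : LineFoliation k M) (f : M → M) : Prop :=
  ∀ x : M, f '' W.leaf x = W.leaf (f x)

/-- The line `TW(x)` tangent to the leaf through `x`, spanned by the velocities of the regular
`C¹` curves in the leaf. -/
def tangentLine (W : LineFoliation k M) (x : M) : Submodule ℝ (TangentSpace (𝓡 (k + 1)) x) :=
  Submodule.span ℝ {v | ∃ (γ : ℝ → M) (ε : ℝ), 0 < ε ∧ γ 0 = x ∧
    IsRegularLeafCurve W.atlas γ (Ioo (-ε) ε) ∧
    v = (mfderiv 𝓘(ℝ, ℝ) (𝓡 (k + 1)) γ 0 (1 : ℝ) : TangentSpace (𝓡 (k + 1)) (γ 0))}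

/-- `X` meets every leaf of `W` in a set of one-dimensional Lebesgue measure zero: for each leaf
and each regular `C¹` parametrization of a piece of it, the parameters of points of `X` form a
Lebesgue null set. -/
def IsLeafwiseNull (W : LineFoliation k M) (X : Set M) : Prop :=
  ∀ (x : M) (γ : ℝ → M) (a b : ℝ), IsRegularLeafCurve W.atlas γ (Ioo a b) →
    MapsTo γ (Ioo a b) (W.leaf x) → volume {t ∈ Ioo a b | γ t ∈ X} = 0

end LineFoliation

/-- `X` has Lebesgue measure zero as a subset of the manifold `M`: its image in every chart is a
Lebesgue null set. -/
def IsManifoldNull (n : ℕ) {M : Type*} [TopologicalSpace M]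
    [ChartedSpace (EuclideanSpace ℝ (Fin n)) M] (X : Set M) : Prop :=
  ∀ e ∈ atlas (EuclideanSpace ℝ (Fin n)) M, volume (e '' (X ∩ e.source)) = 0

namespace LineFoliation

variable {k : ℕ} {M : Type*} [TopologicalSpace M]
  [ChartedSpace (EuclideanSpace ℝ (Fin (k + 1))) M]

/-- `W` is absolutely continuous if every (Borel) set that meets each leaf in a null set is a null
set in `M`. -/
def IsAbsolutelyContinuous (W : LineFoliation k M) : Prop :=
  ∀ X : Set M, MeasurableSet[borel M] X → W.IsLeafwiseNull X → IsManifoldNull (k + 1) X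

end LineFoliation

/-! ### Distances on the universal cover, quasi-isometric foliations, Lyapunov exponents -/

section Riemannian

variable {k : ℕ} {M : Type*} [TopologicalSpace M]
  [ChartedSpace (EuclideanSpace ℝ (Fin (k + 1))) M]
  [RiemannianBundle (fun x : M ↦ TangentSpace (𝓡 (k + 1)) x)]
  {Mt : Type*} [TopologicalSpace Mt]

/-- `γ` is a path from `x` to `y` in the covering space `Mt` of `M` which is `C¹` on `[0, 1]` for
the smooth structure lifted from `M`, that is, whose projection to `M` is `C¹`. -/
def IsLiftedC1Path (k : ℕ) {M : Type*} [TopologicalSpace M]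
    [ChartedSpace (EuclideanSpace ℝ (Fin (k + 1))) M] {Mt : Type*} [TopologicalSpace Mt]
    (P : Mt → M) (x y : Mt) (γ : ℝ → Mt) : Prop :=
  ContinuousOn γ (Icc 0 1) ∧ γ 0 = x ∧ γ 1 = y ∧
    ContMDiffOn 𝓘(ℝ, ℝ) (𝓡 (k + 1)) 1 (P ∘ γ) (Icc 0 1)

/-- The Riemannian distance on the covering space `P : Mt → M` for the Riemannian metric lifted from
`M`: the infimum of the lengths of `C¹` paths, the length of a path being that of its projection. -/
def coverDist (k : ℕ) {M : Type*} [TopologicalSpace M]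
    [ChartedSpace (EuclideanSpace ℝ (Fin (k + 1))) M]
    [RiemannianBundle (fun x : M ↦ TangentSpace (𝓡 (k + 1)) x)]
    {Mt : Type*} [TopologicalSpace Mt] (P : Mt → M) (x y : Mt) : ℝ≥0∞ :=
  ⨅ (γ : ℝ → Mt) (_ : IsLiftedC1Path k P x y γ), pathELength (𝓡 (k + 1)) (P ∘ γ) 0 1

namespace LineFoliation

/-- The leaf through `x` of the foliation of `Mt` lifted from `W`. -/
def coverLeaf {k : ℕ} {M : Type*} [TopologicalSpace M]
    [ChartedSpace (EuclideanSpace ℝ (Fin (k + 1))) M] {Mt : Type*} [TopologicalSpace Mt]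
    (W : LineFoliation k M) (P : Mt → M) (x : Mt) : Set Mt :=
  {y | ∃ γ : ℝ → Mt, ContinuousOn γ (Icc 0 1) ∧ IsLeafwise W.atlas (P ∘ γ) (Icc 0 1) ∧
    γ 0 = x ∧ γ 1 = y}

/-- The distance along the leaves of the lifted foliation: the infimum of the lengths of the `C¹`
paths that stay in the leaf. -/
def coverLeafDist (W : LineFoliation k M) (P : Mt → M) (x y : Mt) : ℝ≥0∞ :=
  ⨅ (γ : ℝ → Mt) (_ : IsLiftedC1Path k P x y γ ∧ IsLeafwise W.atlas (P ∘ γ) (Icc 0 1)),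
    pathELength (𝓡 (k + 1)) (P ∘ γ) 0 1

/-- `W` is quasi-isometric: there is a constant `Q > 1` such that
`d_leaf(x, y) < Q d(x, y) + Q` for all points `x`, `y` on the same leaf of the lift of `W` to the
universal cover `P : Mt → M`. -/
def IsQuasiIsometric (W : LineFoliation k M) (P : Mt → M) : Prop :=
  ∃ Q : ℝ≥0, 1 < Q ∧ ∀ x : Mt, ∀ y ∈ W.coverLeaf P x,
    W.coverLeafDist P x y < Q * coverDist k P x y + Q

/-- The leafwise Lyapunov exponent of `f` at `x` exists and equals `l`:
`(1 / n) log ‖Tfⁿ|_{TW(x)}‖ → l` as `|n| → ∞`, `n ∈ ℤ`. -/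
def HasLyapunovExponent (W : LineFoliation k M) (f : M ≃ M) (x : M) (l : ℝ) : Prop :=
  Tendsto (fun n : ℤ ↦ (1 / (n : ℝ)) * Real.log
      ‖(mfderiv (𝓡 (k + 1)) (𝓡 (k + 1)) (⇑((f : Equiv.Perm M) ^ n)) x).comp
        (W.tangentLine x).subtypeL‖) cofinite (𝓝 l)

/-- The set of points at which the leafwise Lyapunov exponent exists and is nonzero. -/
def nonzeroExponentSet (W : LineFoliation k M) (f : M ≃ M) : Set M :=
  {x | ∃ l : ℝ, W.HasLyapunovExponent f x l ∧ l ≠ 0}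

end LineFoliation

end Riemannian

end

/-! Leafwise lengths cannot grow exponentially under iteration, whereas a nonzero exponent on a set
of positive measure in a leaf would force them to. Since `f⁻¹` satisfies the same hypotheses, it is
enough to exclude positive exponents in forward time.

Take a short arc of a leaf. Lift it to homotopy classes of paths from the base point, on which `f`
acts by `α ↦ δ · f(α)`, `δ` being a fixed path from `x₀` to `f x₀`. Comparing these classes with
reference paths that run through a finite net of `M` turns each point of the `n`-th image into an
element of the fundamental group. One iteration applies an automorphism and makes a bounded error,
so these elements stay in a sequence `A_{k+1} = U_N(φ(A_k))`. Unstretchability bounds the word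
diameter polynomially. Hence the subarcs of the `n`-th image are homotopic to `C¹` paths of
polynomial length (`exists_polynomial_hasC1Rep`).

Lifted to the cover, this bounds the distance between end points of subarcs, and quasi-isometry
converts it into a bound for the distance along the leaf (`exists_leafwise_path`). A path in the
leaf need not follow the arc, because a closed leaf can be traversed the other way. If all points of
the arc are close to one end along the leaf, though, the arc itself is at most twice as long
(`pathELength_le_two_mul`). So the length of the `n`-th image, which is the integral of the speed of
`f^n ∘ γ`, is at most polynomial (`exists_pathELength_iterate_le`).

Summing these integrals with weights `(n + 1)^{-(d+2)}` shows that at almost every parameter the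
speeds are polynomially bounded in `n` (`ae_exists_forall_le_mul_pow`), which rules out a positive
exponent there. For the last claim the set must be Borel. The tangent direction is a limit of
secants along plaques, and these vary continuously with the point
(`measurable_norm_mfderiv_comp_tangentLine`). -/

/-! ### Leafwise curves and the countably many plaques of a leaf. -/

theorem Set.countable_image_of_locallyConst {X Y : Type*} [TopologicalSpace X]
    [SecondCountableTopology X] {s : Set X} {g : X → Y}
    (h : ∀ x ∈ s, ∃ V ∈ 𝓝 x, ∀ y ∈ V ∩ s, g y = g x) : (g '' s).Countable := by
  choose! V hV hg using h
  obtain ⟨t, hts, ht, hcov⟩ := TopologicalSpace.countable_cover_nhdsWithin (s := s)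
    (f := fun x ↦ V x) fun x hx ↦ mem_nhdsWithin_of_mem_nhds (hV x hx)
  refine (ht.image g).mono ?_
  rintro _ ⟨y, hy, rfl⟩
  obtain ⟨x, hx, hyx⟩ := mem_iUnion₂.1 (hcov hy)
  exact ⟨x, hx, (hg x (hts hx) y ⟨hyx, hy⟩).symm⟩

section Leafwise

variable {k : ℕ} {M : Type*} [TopologicalSpace M]
  {A : Set (OpenPartialHomeomorph M (ℝ × EuclideanSpace ℝ (Fin k)))}
  {γ : ℝ → M} {s : Set ℝ}

theorem IsLeafwise.comp (h : IsLeafwise A γ s) {σ : ℝ → ℝ} {s' : Set ℝ}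
    (hσ : ContinuousOn σ s') (hm : MapsTo σ s' s) : IsLeafwise A (γ ∘ σ) s' :=
  ⟨h.1.comp hσ hm, fun t ht φ hφ hs ↦
    ((hσ t ht).tendsto_nhdsWithin hm).eventually (h.2 (σ t) (hm ht) φ hφ hs)⟩

theorem IsLeafwise.mono (h : IsLeafwise A γ s) {s' : Set ℝ} (hs : s' ⊆ s) :
    IsLeafwise A γ s' :=
  h.comp continuousOn_id hs

theorem IsLeafwise.congr (h : IsLeafwise A γ s) {η : ℝ → M} (hη : EqOn η γ s) :
    IsLeafwise A η s := by
  refine ⟨h.1.congr hη, fun t ht φ hφ hs ↦ ?_⟩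
  rw [hη ht] at hs ⊢
  filter_upwards [h.2 t ht φ hφ hs, self_mem_nhdsWithin] with r hr hrs
  rw [hη hrs, hr]

end Leafwise

namespace LineFoliation

variable {k : ℕ} {M : Type*} [TopologicalSpace M]
  [ChartedSpace (EuclideanSpace ℝ (Fin (k + 1))) M] (W : LineFoliation k M)

theorem mem_leaf_of_isLeafwise {γ : ℝ → M} {s : Set ℝ} (hs : s.OrdConnected)
    (h : IsLeafwise W.atlas γ s) {t₀ t : ℝ} (ht₀ : t₀ ∈ s) (ht : t ∈ s) :
    γ t ∈ W.leaf (γ t₀) := by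
  refine ⟨γ ∘ fun r ↦ t₀ + r * (t - t₀), h.comp (by fun_prop) ?_, by simp, by simp⟩
  intro r hr
  refine hs.uIcc_subset ht₀ ht ?_
  have := (convex_uIcc t₀ t).add_smul_sub_mem left_mem_uIcc right_mem_uIcc hr
  simpa using this

/-- The union of the plaques, in the given charts, that meet a set. -/
def saturation {ι : Type*} (T : Set ι)
    (c : ι → OpenPartialHomeomorph M (ℝ × EuclideanSpace ℝ (Fin k))) (K : Set M) : Set M :=
  {q | ∃ p ∈ T, q ∈ (c p).source ∧ ∃ q' ∈ K, q' ∈ (c p).source ∧ (c p q).2 = (c p q').2}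

/-- Only countably many plaques of the given charts meet `K`. On each of them the transverse
coordinate of another chart is locally constant by compatibility, so it takes countably many values.
-/
theorem countable_saturation [SecondCountableTopology M] {ι : Type*} {T : Set ι}
    (hT : T.Countable) {c : ι → OpenPartialHomeomorph M (ℝ × EuclideanSpace ℝ (Fin k))}
    (hc : ∀ p, c p ∈ W.atlas) {K : Set M}
    (hK : ∀ φ ∈ W.atlas, ((fun q ↦ (φ q).2) '' (K ∩ φ.source)).Countable) :
    ∀ φ ∈ W.atlas, ((fun q ↦ (φ q).2) '' (saturation T c K ∩ φ.source)).Countable := by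
  intro φ hφ
  have key : saturation T c K ∩ φ.source ⊆ ⋃ p ∈ T, ⋃ y ∈ (fun q ↦ (c p q).2) '' (K ∩ (c p).source),
      {q | q ∈ (c p).source ∧ q ∈ φ.source ∧ (c p q).2 = y} := by
    rintro q ⟨⟨p, hp, hq, q', hq', hq's, he⟩, hqφ⟩
    simp only [mem_iUnion]
    exact ⟨p, hp, (c p q').2, ⟨q', ⟨hq', hq's⟩, rfl⟩, hq, hqφ, he⟩
  refine Countable.mono (image_mono key) ?_
  simp only [image_iUnion]
  refine hT.biUnion fun p _ ↦ (hK _ (hc p)).biUnion fun y _ ↦ ?_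
  refine Set.countable_image_of_locallyConst ?_
  rintro q ⟨hq, hqφ, hy⟩
  obtain ⟨V, hV, h⟩ := W.compatible _ (hc p) φ hφ q ⟨hq, hqφ⟩
  refine ⟨V, hV, ?_⟩
  rintro q' ⟨hq'V, -, -, hy'⟩
  exact h q' hq'V q (mem_of_mem_nhds hV) (hy'.trans hy.symm)

/-- Repeated saturation of `{x}` by the plaques of a countable cover exhausts the leaf, since a
leafwise path can neither enter nor leave the union of the saturations. The point of the lemma is
that invariance is a statement about leaves as sets, while leafwise curves are defined by plaques.
-/
theorem countable_image_leaf [SecondCountableTopology M] (x : M) :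
    ∀ φ ∈ W.atlas, ((fun q ↦ (φ q).2) '' (W.leaf x ∩ φ.source)).Countable := by
  choose c hcA hc using W.cover
  obtain ⟨T, hT, hcov⟩ := TopologicalSpace.countable_cover_nhds
    (f := fun p ↦ (c p).source) fun p ↦ (c p).open_source.mem_nhds (hc p)
  let K : ℕ → Set M := fun n ↦ (saturation T c)^[n] {x}
  have hK : ∀ n, ∀ φ ∈ W.atlas, ((fun q ↦ (φ q).2) '' (K n ∩ φ.source)).Countable := by
    intro n
    induction n with
    | zero => exact fun φ _ ↦ ((countable_singleton x).mono inter_subset_left).image _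
    | succ n ih =>
      simp only [K, Function.iterate_succ_apply']
      exact W.countable_saturation hT hcA ih
  have hsub : W.leaf x ⊆ ⋃ n, K n := by
    rintro y ⟨γ, hγ, h0, h1⟩
    have := isPreconnected_Icc.induction₂ (s := Icc (0 : ℝ) 1)
      (fun r r' ↦ γ r ∈ (⋃ n, K n) ↔ γ r' ∈ (⋃ n, K n)) ?_
      (fun _ _ _ _ _ _ h h' ↦ h.trans h') (fun _ _ _ _ h ↦ h.symm)
      (left_mem_Icc.2 zero_le_one) (right_mem_Icc.2 zero_le_one)
    · rw [← h1, ← this, h0]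
      exact mem_iUnion.2 ⟨0, rfl⟩
    · intro r hr
      obtain ⟨p, hp, hrp⟩ := mem_iUnion₂.1 (hcov.symm ▸ mem_univ (γ r))
      filter_upwards [hγ.2 r hr _ (hcA p) hrp,
        (hγ.1 r hr).eventually ((c p).open_source.mem_nhds hrp)] with r' he hs
      simp only [mem_iUnion]
      constructor
      · rintro ⟨n, hn⟩
        refine ⟨n + 1, ?_⟩
        simp only [K, Function.iterate_succ_apply']
        exact ⟨p, hp, hs, _, hn, hrp, he⟩
      · rintro ⟨n, hn⟩
        refine ⟨n + 1, ?_⟩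
        simp only [K, Function.iterate_succ_apply']
        exact ⟨p, hp, hrp, _, hn, hs, he.symm⟩
  intro φ hφ
  refine Countable.mono (image_mono (inter_subset_inter_left _ hsub)) ?_
  rw [iUnion_inter, image_iUnion]
  exact countable_iUnion fun n ↦ hK n φ hφ

/-- A continuous curve in a leaf stays locally in a plaque. -/
theorem isLeafwise_of_mapsTo_leaf [SecondCountableTopology M] {γ : ℝ → M} {s : Set ℝ}
    (hs : s.OrdConnected) (hγ : ContinuousOn γ s) {x : M} (hx : MapsTo γ s (W.leaf x)) :
    IsLeafwise W.atlas γ s := by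
  refine ⟨hγ, fun t ht φ hφ hts ↦ ?_⟩
  obtain ⟨δ, hδ, hsub⟩ := Metric.mem_nhdsWithin_iff.1
    ((hγ t ht).preimage_mem_nhdsWithin (φ.open_source.mem_nhds hts))
  have hconn : IsPreconnected (Metric.ball t δ ∩ s) := by
    rw [Real.ball_eq_Ioo]
    exact (ordConnected_Ioo.inter hs).isPreconnected
  have hcont : ContinuousOn (fun r ↦ (φ (γ r)).2) (Metric.ball t δ ∩ s) :=
    continuous_snd.comp_continuousOn (φ.continuousOn.comp (hγ.mono inter_subset_right) hsub)
  -- A connected subset of a countable set in Euclidean space is at most a point.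
  have hsubs : ((fun r ↦ (φ (γ r)).2) '' (Metric.ball t δ ∩ s)).Subsingleton :=
    (W.countable_image_leaf x φ hφ).isTotallyDisconnected _
      (by
        rintro _ ⟨r, hr, rfl⟩
        exact ⟨γ r, ⟨hx hr.2, hsub hr⟩, rfl⟩) (hconn.image _ hcont)
  filter_upwards [inter_mem (mem_nhdsWithin_of_mem_nhds (Metric.ball_mem_nhds t hδ))
    self_mem_nhdsWithin] with r hr
  exact hsubs ⟨r, hr, rfl⟩ ⟨t, ⟨Metric.mem_ball_self hδ, ht⟩, rfl⟩

variable {W}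

theorem IsInvariant.isLeafwise_comp [SecondCountableTopology M] {f : M → M}
    (hf : W.IsInvariant f) (hfc : Continuous f) {γ : ℝ → M} {s : Set ℝ} (hs : s.OrdConnected)
    (h : IsLeafwise W.atlas γ s) : IsLeafwise W.atlas (f ∘ γ) s := by
  rcases s.eq_empty_or_nonempty with rfl | ⟨t₀, ht₀⟩
  · exact ⟨continuousOn_empty _, fun t ht ↦ ht.elim⟩
  refine W.isLeafwise_of_mapsTo_leaf (x := f (γ t₀)) hs (hfc.comp_continuousOn h.1) fun t ht ↦ ?_
  rw [← hf]
  exact mem_image_of_mem f (W.mem_leaf_of_isLeafwise hs h ht₀ ht)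

theorem IsInvariant.symm {f : M ≃ M} (hf : W.IsInvariant f) : W.IsInvariant f.symm := by
  intro x
  rw [← f.symm_image_image (W.leaf (f.symm x)), hf, f.apply_symm_apply]

end LineFoliation

/-! ### Regular `C¹` curves and their continuous reparametrizations. -/

theorem mfderiv_comp_one {E : Type*} [NormedAddCommGroup E] [NormedSpace ℝ E]
    {M : Type*} [TopologicalSpace M] [ChartedSpace E M] {γ : ℝ → M} {σ : ℝ → ℝ} {s₀ r : ℝ}
    (hγ : MDifferentiableAt 𝓘(ℝ, ℝ) 𝓘(ℝ, E) γ (σ s₀)) (hσ : HasDerivAt σ r s₀) :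
    mfderiv 𝓘(ℝ, ℝ) 𝓘(ℝ, E) (γ ∘ σ) s₀ 1 = r • (mfderiv 𝓘(ℝ, ℝ) 𝓘(ℝ, E) γ (σ s₀) 1) := by
  have h1 : HasMFDerivAt 𝓘(ℝ, ℝ) 𝓘(ℝ, ℝ) σ s₀ (ContinuousLinearMap.toSpanSingleton ℝ r) :=
    hσ.hasFDerivAt.hasMFDerivAt
  have h2 := (hγ.hasMFDerivAt.comp s₀ h1).mfderiv
  rw [h2]
  change mfderiv 𝓘(ℝ, ℝ) 𝓘(ℝ, E) γ (σ s₀) ((1 : ℝ) • r) = _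
  rw [one_smul, ← map_smul]
  congr 1
  exact (mul_one r).symm

section RegularCurve

variable {E : Type*} [NormedAddCommGroup E] [NormedSpace ℝ E]
  {M : Type*} [TopologicalSpace M] [ChartedSpace E M] [IsManifold 𝓘(ℝ, E) 1 M]
  {γ : ℝ → M} {t₀ : ℝ}

/-- Along a `C¹` curve with nonzero velocity, some `C¹` function has nonzero derivative. -/
theorem exists_contMDiffAt_hasStrictDerivAt_comp (hγ : ContMDiffAt 𝓘(ℝ, ℝ) 𝓘(ℝ, E) 1 γ t₀)
    (h0 : mfderiv 𝓘(ℝ, ℝ) 𝓘(ℝ, E) γ t₀ 1 ≠ 0) :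
    ∃ ℓ : M → ℝ, ContMDiffAt 𝓘(ℝ, E) 𝓘(ℝ, ℝ) 1 ℓ (γ t₀) ∧
      ∃ d ≠ 0, HasStrictDerivAt (ℓ ∘ γ) d t₀ := by
  let e := extChartAt 𝓘(ℝ, E) (γ t₀)
  have he : ContMDiffAt 𝓘(ℝ, E) 𝓘(ℝ, E) 1 e (γ t₀) := contMDiffAt_extChartAt
  let v : E := mfderiv 𝓘(ℝ, E) 𝓘(ℝ, E) e (γ t₀) (mfderiv 𝓘(ℝ, ℝ) 𝓘(ℝ, E) γ t₀ 1)
  have hv : v ≠ 0 := by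
    intro h
    refine h0 ((isInvertible_mfderiv_extChartAt (mem_extChartAt_source (γ t₀))).injective ?_)
    rw [map_zero]
    exact h
  obtain ⟨L, hL⟩ := SeparatingDual.exists_ne_zero (R := ℝ) (V := E) hv
  refine ⟨fun x ↦ L (e x), (L.contMDiff.contMDiffAt).comp _ he, L v, hL, ?_⟩
  have hu : HasStrictDerivAt (e ∘ γ) (deriv (e ∘ γ) t₀) t₀ :=
    ((he.comp t₀ hγ).contDiffAt).hasStrictDerivAt one_ne_zero
  have hd : deriv (e ∘ γ) t₀ = v := by
    have h1 := mfderiv_comp t₀ (he.mdifferentiableAt one_ne_zero)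
      (hγ.mdifferentiableAt one_ne_zero)
    rw [mfderiv_eq_fderiv] at h1
    rw [← fderiv_apply_one_eq_deriv]
    exact congrArg (fun T : ℝ →L[ℝ] E ↦ T 1) h1
  rw [← hd]
  exact L.hasStrictFDerivAt.comp_hasStrictDerivAt t₀ hu

theorem exists_injOn_of_mfderiv_ne_zero (hγ : ContMDiffAt 𝓘(ℝ, ℝ) 𝓘(ℝ, E) 1 γ t₀)
    (h0 : mfderiv 𝓘(ℝ, ℝ) 𝓘(ℝ, E) γ t₀ 1 ≠ 0) : ∃ U ∈ 𝓝 t₀, InjOn γ U := by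
  obtain ⟨ℓ, -, d, hd, h⟩ := exists_contMDiffAt_hasStrictDerivAt_comp hγ h0
  refine ⟨_, h.eventually_left_inverse hd, fun s hs t ht hst ↦ ?_⟩
  have hs' : _ = s := hs
  have ht' : _ = t := ht
  rw [← hs', ← ht', Function.comp_apply, Function.comp_apply, hst]

/-- A continuous change of parameter between a curve that is differentiable at a point and a
regular `C¹` curve is differentiable at that point. -/
theorem exists_hasDerivAt_of_eventuallyEq_comp {η : ℝ → M} {σ : ℝ → ℝ} {s₀ : ℝ}
    (hγ : ContMDiffAt 𝓘(ℝ, ℝ) 𝓘(ℝ, E) 1 γ (σ s₀))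
    (h0 : mfderiv 𝓘(ℝ, ℝ) 𝓘(ℝ, E) γ (σ s₀) 1 ≠ 0)
    (hη : MDifferentiableAt 𝓘(ℝ, ℝ) 𝓘(ℝ, E) η s₀) (hσ : ContinuousAt σ s₀)
    (h : η =ᶠ[𝓝 s₀] γ ∘ σ) : ∃ r, HasDerivAt σ r s₀ := by
  obtain ⟨ℓ, hℓ, d, hd, hs⟩ := exists_contMDiffAt_hasStrictDerivAt_comp hγ h0
  have hη0 : η s₀ = γ (σ s₀) := h.self_of_nhds
  have hD : DifferentiableAt ℝ (ℓ ∘ η) s₀ := by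
    rw [← mdifferentiableAt_iff_differentiableAt]
    refine MDifferentiableAt.comp s₀ ?_ hη
    rw [hη0]
    exact hℓ.mdifferentiableAt one_ne_zero
  have hg := (hs.to_localInverse hd).hasDerivAt
  have hval : (ℓ ∘ η) s₀ = (ℓ ∘ γ) (σ s₀) := by simp [hη0]
  rw [← hval] at hg
  -- Near `s₀` the change of parameter is `σ = (ℓ ∘ γ)⁻¹ ∘ (ℓ ∘ η)`, with the local inverse from the
  -- inverse function theorem.
  refine ⟨_, (hg.comp s₀ hD.hasDerivAt).congr_of_eventuallyEq ?_⟩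
  filter_upwards [h, hσ.eventually (hs.eventually_left_inverse hd)] with t ht ht'
  rw [Function.comp_apply, Function.comp_apply, ht, Function.comp_apply]
  exact ht'.symm

end RegularCurve

theorem exists_mem_image_of_injOn_Icc {g : ℝ → ℝ} {a b s : ℝ} (hs : s ∈ Ioo a b)
    (hc : ContinuousOn g (Icc a b)) (hi : InjOn g (Icc a b)) : g '' Icc a b ∈ 𝓝 (g s) := by
  have hab : a ≤ b := (hs.1.trans hs.2).le
  have ha := left_mem_Icc.2 hab
  have hb := right_mem_Icc.2 hab
  have hs' := Ioo_subset_Icc_self hs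
  rcases hc.strictMonoOn_of_injOn_Icc' hab hi with h | h
  · exact mem_of_superset (Icc_mem_nhds (h ha hs' hs.1) (h hs' hb hs.2))
      (intermediate_value_Icc hab hc)
  · exact mem_of_superset (Icc_mem_nhds (h hs' hb hs.2) (h ha hs' hs.1))
      (intermediate_value_Icc' hab hc)

/-- A continuous lift through an injective curve on a compact interval. -/
theorem exists_continuousOn_comp_eq {M : Type*} [TopologicalSpace M] [T2Space M] {γ η : ℝ → M}
    {p q : ℝ} (hγ : ContinuousOn γ (Icc p q)) (hi : InjOn γ (Icc p q)) {T : Set ℝ}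
    (hη : ContinuousOn η T) (hm : MapsTo η T (γ '' Icc p q)) :
    ∃ σ : ℝ → ℝ, ContinuousOn σ T ∧ MapsTo σ T (Icc p q) ∧ EqOn η (γ ∘ σ) T := by
  have hm' : ∀ t ∈ T, ∃ s ∈ Icc p q, γ s = η t := hm
  choose! σ hσ hσe using hm'
  refine ⟨σ, ?_, hσ, fun t ht ↦ (hσe t ht).symm⟩
  have hemb : Topology.IsEmbedding ((Icc p q).domRestrict γ) :=
    (hγ.domRestrict.isClosedEmbedding (injOn_iff_injective.1 hi)).isEmbedding
  have hl : Continuous (fun t : T ↦ (⟨σ t, hσ t t.2⟩ : Icc p q)) := by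
    rw [hemb.continuous_iff]
    have : (Icc p q).domRestrict γ ∘ (fun t : T ↦ (⟨σ t, hσ t t.2⟩ : Icc p q)) =
        T.domRestrict η := funext fun t ↦ hσe t t.2
    rw [this]
    exact hη.domRestrict
  rw [continuousOn_iff_continuous_domRestrict]
  exact continuous_subtype_val.comp hl

section LeafCurve

variable {k : ℕ} {M : Type*} [TopologicalSpace M]
  [ChartedSpace (EuclideanSpace ℝ (Fin (k + 1))) M]
  {A : Set (OpenPartialHomeomorph M (ℝ × EuclideanSpace ℝ (Fin k)))}
  {γ : ℝ → M} {s : Set ℝ}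

theorem IsRegularLeafCurve.contMDiffAt (h : IsRegularLeafCurve A γ s) (hs : IsOpen s) {t : ℝ}
    (ht : t ∈ s) : ContMDiffAt 𝓘(ℝ, ℝ) (𝓡 (k + 1)) 1 γ t :=
  h.2.1.contMDiffAt (hs.mem_nhds ht)

theorem IsRegularLeafCurve.mono (h : IsRegularLeafCurve A γ s) {s' : Set ℝ} (hs : s' ⊆ s) :
    IsRegularLeafCurve A γ s' :=
  ⟨h.1.mono hs, h.2.1.mono hs, fun t ht ↦ h.2.2 t (hs ht)⟩

variable [IsManifold (𝓡 (k + 1)) 1 M]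

/-- Near a point, a leafwise curve through a point of a regular leaf curve takes its values in that
regular leaf curve. -/
theorem IsRegularLeafCurve.eventually_mem_image (h : IsRegularLeafCurve A γ s) (hs : IsOpen s)
    {t₀ : ℝ} (ht₀ : t₀ ∈ s) {O : Set ℝ} (hO : O ∈ 𝓝 t₀) {φ} (hφ : φ ∈ A) (hφs : γ t₀ ∈ φ.source)
    {η : ℝ → M} {T : Set ℝ} (hη : IsLeafwise A η T) {r₀ : ℝ} (hr₀ : r₀ ∈ T) (he : η r₀ = γ t₀) :
    ∀ᶠ r in 𝓝[T] r₀, η r ∈ γ '' O := by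
  obtain ⟨U, hU, hinj⟩ := exists_injOn_of_mfderiv_ne_zero (h.contMDiffAt hs ht₀) (h.2.2 t₀ ht₀)
  have hev : ∀ᶠ t in 𝓝 t₀, t ∈ s ∧ t ∈ O ∧ t ∈ U ∧ γ t ∈ φ.source ∧ (φ (γ t)).2 = (φ (γ t₀)).2 := by
    have h1 := h.1.2 t₀ ht₀ φ hφ hφs
    rw [hs.nhdsWithin_eq ht₀] at h1
    have h2 := (h.contMDiffAt hs ht₀).continuousAt.eventually (φ.open_source.mem_nhds hφs)
    filter_upwards [hs.mem_nhds ht₀, hO, hU, h1, h2] with t a b c d e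
    exact ⟨a, b, c, e, d⟩
  obtain ⟨a, b, hab, habs⟩ := mem_nhds_iff_exists_Ioo_subset.1 hev
  obtain ⟨a', ha', ha't⟩ := exists_between hab.1
  obtain ⟨b', hb't, hb'⟩ := exists_between hab.2
  have hsub : ∀ t ∈ Icc a' b', t ∈ s ∧ t ∈ O ∧ t ∈ U ∧ γ t ∈ φ.source ∧
      (φ (γ t)).2 = (φ (γ t₀)).2 :=
    fun t ht ↦ habs ⟨ha'.trans_le ht.1, ht.2.trans_lt hb'⟩
  have hcont : ContinuousOn (fun t ↦ (φ (γ t)).1) (Icc a' b') :=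
    continuous_fst.comp_continuousOn
      (φ.continuousOn.comp (h.1.1.mono fun t ht ↦ (hsub t ht).1) fun t ht ↦ (hsub t ht).2.2.2.1)
  -- The transverse coordinate is constant along `γ`, so the plaque coordinate inherits injectivity
  -- from `γ`. Its image is then a neighbourhood in the plaque, and every leafwise curve through the
  -- point must run in it for a while.
  have hinj' : InjOn (fun t ↦ (φ (γ t)).1) (Icc a' b') := by
    intro t ht t' ht' htt
    refine hinj (hsub t ht).2.2.1 (hsub t' ht').2.2.1
      (φ.injOn (hsub t ht).2.2.2.1 (hsub t' ht').2.2.2.1 (Prod.ext htt ?_))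
    rw [(hsub t ht).2.2.2.2, (hsub t' ht').2.2.2.2]
  have hnhds := exists_mem_image_of_injOn_Icc ⟨ha't, hb't⟩ hcont hinj'
  have hηs : η r₀ ∈ φ.source := he ▸ hφs
  have hηc : Tendsto (fun r ↦ (φ (η r)).1) (𝓝[T] r₀) (𝓝 (φ (γ t₀)).1) := by
    rw [← he]
    exact (continuous_fst.continuousAt.comp (φ.continuousAt hηs)).tendsto.comp (hη.1 r₀ hr₀)
  filter_upwards [hηc hnhds, hη.2 r₀ hr₀ φ hφ hηs,
    (hη.1 r₀ hr₀).eventually (φ.open_source.mem_nhds hηs)] with r hr hr2 hrs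
  obtain ⟨t, ht, hte⟩ := hr
  refine ⟨t, (hsub t ht).2.1, φ.injOn (hsub t ht).2.2.2.1 hrs (Prod.ext hte ?_)⟩
  rw [(hsub t ht).2.2.2.2, hr2, he]

end LeafCurve

/-! ### Speed and length. -/

theorem ContinuousOn.norm_bundle {B : Type*} [TopologicalSpace B] {F : Type*}
    [NormedAddCommGroup F] [NormedSpace ℝ F] {V : B → Type*} [TopologicalSpace (TotalSpace F V)]
    [∀ x, NormedAddCommGroup (V x)] [∀ x, InnerProductSpace ℝ (V x)] [FiberBundle F V]
    [VectorBundle ℝ F V] [IsContinuousRiemannianBundle F V] {X : Type*} [TopologicalSpace X]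
    {b : X → B} {v : ∀ x, V (b x)} {s : Set X}
    (hv : ContinuousOn (fun m ↦ (v m : TotalSpace F V)) s) : ContinuousOn (fun m ↦ ‖v m‖) s := by
  simp only [norm_eq_sqrt_real_inner]
  exact Real.continuous_sqrt.comp_continuousOn (hv.inner_bundle hv)

section Speed

variable {E : Type*} [NormedAddCommGroup E] [NormedSpace ℝ E]
  {M : Type*} [TopologicalSpace M] [ChartedSpace E M]
  [RiemannianBundle (fun x : M ↦ TangentSpace 𝓘(ℝ, E) x)]

/-- The norm of the velocity of a curve. -/
noncomputable def speed (E : Type*) [NormedAddCommGroup E] [NormedSpace ℝ E]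
    {M : Type*} [TopologicalSpace M] [ChartedSpace E M]
    [RiemannianBundle (fun x : M ↦ TangentSpace 𝓘(ℝ, E) x)] (γ : ℝ → M) (t : ℝ) : ℝ :=
  ‖mfderiv 𝓘(ℝ, ℝ) 𝓘(ℝ, E) γ t 1‖

/-- All tangent spaces unfold to `E`, but the norm depends on the base point; this transports it
along an equality of base points. -/
theorem norm_tangentSpace_congr {x y : M} (h : x = y) {v : TangentSpace 𝓘(ℝ, E) x}
    {w : TangentSpace 𝓘(ℝ, E) y} (hvw : (v : E) = w) : ‖v‖ = ‖w‖ := by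
  subst h
  exact congrArg (fun u : TangentSpace 𝓘(ℝ, E) x ↦ ‖u‖) hvw

theorem speed_nonneg (γ : ℝ → M) (t : ℝ) : 0 ≤ speed E γ t := norm_nonneg _

theorem speed_congr {γ η : ℝ → M} {t : ℝ} (h : γ =ᶠ[𝓝 t] η) : speed E γ t = speed E η t := by
  have A : γ t = η t := h.self_of_nhds
  exact norm_tangentSpace_congr A
    (congrArg (fun T : ℝ →L[ℝ] E ↦ T 1) (h.mfderiv_eq (I := 𝓘(ℝ, ℝ)) (I' := 𝓘(ℝ, E))))

theorem speed_comp {γ : ℝ → M} {σ : ℝ → ℝ} {t r : ℝ}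
    (hγ : MDifferentiableAt 𝓘(ℝ, ℝ) 𝓘(ℝ, E) γ (σ t)) (hσ : HasDerivAt σ r t) :
    speed E (γ ∘ σ) t = |r| * speed E γ (σ t) := by
  unfold speed
  rw [mfderiv_comp_one hγ hσ, ← Real.norm_eq_abs]
  exact norm_smul r (mfderiv 𝓘(ℝ, ℝ) 𝓘(ℝ, E) γ (σ t) 1)

theorem pathELength_eq_lintegral_speed (γ : ℝ → M) (a b : ℝ) :
    pathELength 𝓘(ℝ, E) γ a b = ∫⁻ t in Icc a b, ENNReal.ofReal (speed E γ t) := by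
  rw [pathELength_eq_lintegral_mfderiv_Icc]
  simp only [speed, ofReal_norm]

variable [IsManifold 𝓘(ℝ, E) 1 M]
  [IsContinuousRiemannianBundle E (fun x : M ↦ TangentSpace 𝓘(ℝ, E) x)]

theorem continuousOn_speed {γ : ℝ → M} {s : Set ℝ} (hs : IsOpen s)
    (hγ : ContMDiffOn 𝓘(ℝ, ℝ) 𝓘(ℝ, E) 1 γ s) : ContinuousOn (speed E γ) s := by
  have h1 : Continuous fun t : ℝ ↦ (⟨t, 1⟩ : TangentBundle 𝓘(ℝ, ℝ) ℝ) :=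
    (tangentBundleModelSpaceHomeomorph 𝓘(ℝ, ℝ)).symm.continuous.comp
      (continuous_id.prodMk continuous_const : Continuous fun t : ℝ ↦ ((t, 1) : ℝ × ℝ))
  have h2 : ContinuousOn (fun t : ℝ ↦ tangentMapWithin 𝓘(ℝ, ℝ) 𝓘(ℝ, E) γ s ⟨t, 1⟩) s :=
    (hγ.continuousOn_tangentMapWithin le_rfl hs.uniqueMDiffOn).comp h1.continuousOn
      fun t ht ↦ ht
  have h3 : ContinuousOn (fun t : ℝ ↦
      (⟨γ t, mfderivWithin 𝓘(ℝ, ℝ) 𝓘(ℝ, E) γ s t 1⟩ : TangentBundle 𝓘(ℝ, E) M)) s := h2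
  refine (ContinuousOn.norm_bundle (V := fun x : M ↦ TangentSpace 𝓘(ℝ, E) x) h3).congr
    fun t ht ↦ ?_
  simp only [speed, mfderivWithin_of_isOpen hs ht]

theorem pathELength_eq_ofReal_integral {γ : ℝ → M} {a b p q : ℝ}
    (hγ : ContMDiffOn 𝓘(ℝ, ℝ) 𝓘(ℝ, E) 1 γ (Ioo a b)) (hp : a < p) (hpq : p ≤ q) (hq : q < b) :
    pathELength 𝓘(ℝ, E) γ p q = ENNReal.ofReal (∫ t in p..q, speed E γ t) := by
  have hc : ContinuousOn (speed E γ) (Icc p q) :=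
    (continuousOn_speed isOpen_Ioo hγ).mono fun t ht ↦ ⟨hp.trans_le ht.1, ht.2.trans_lt hq⟩
  rw [pathELength_eq_lintegral_speed, intervalIntegral.integral_of_le hpq,
    ← integral_Icc_eq_integral_Ioc,
    ofReal_integral_eq_lintegral_ofReal hc.integrableOn_Icc
      (Eventually.of_forall fun t ↦ speed_nonneg γ t)]

/-- If `η = γ ∘ σ`, then `η` is at least as long as the arc of `γ` between the extreme values of the
parameter `σ`. -/
theorem ofReal_abs_integral_speed_le {γ η : ℝ → M} {σ : ℝ → ℝ} {a b u v : ℝ}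
    (hγ : ContMDiffOn 𝓘(ℝ, ℝ) 𝓘(ℝ, E) 1 γ (Ioo a b))
    (h0 : ∀ t ∈ Ioo a b, mfderiv 𝓘(ℝ, ℝ) 𝓘(ℝ, E) γ t 1 ≠ 0) (huv : u ≤ v)
    (hη : ContMDiffOn 𝓘(ℝ, ℝ) 𝓘(ℝ, E) 1 η (Ioo u v)) (hσ : ContinuousOn σ (Icc u v))
    (hm : MapsTo σ (Icc u v) (Ioo a b)) (he : EqOn η (γ ∘ σ) (Icc u v)) :
    ENNReal.ofReal |∫ t in σ u..σ v, speed E γ t| ≤ pathELength 𝓘(ℝ, E) η u v := by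
  -- `η` is `C¹` only on the open interval, so integrability up to the ends, needed for the
  -- fundamental theorem of calculus, has to come from finite length.
  rcases eq_or_ne (pathELength 𝓘(ℝ, E) η u v) ⊤ with htop | hfin
  · rw [htop]; exact le_top
  have hcs := continuousOn_speed isOpen_Ioo hγ
  have hu := hm (left_mem_Icc.2 huv)
  have hint : ∀ x ∈ Ioo a b, ∀ y ∈ Ioo a b, IntervalIntegrable (speed E γ) volume x y :=
    fun x hx y hy ↦ (hcs.mono (ordConnected_Ioo.uIcc_subset hx hy)).intervalIntegrable
  -- `S` is signed arc length along `γ`; the derivative of `S ∘ σ` has absolute value the speed of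
  -- `η`.
  let S : ℝ → ℝ := fun τ ↦ ∫ t in σ u..τ, speed E γ t
  have hS : ∀ τ ∈ Ioo a b, HasDerivAt S (speed E γ τ) τ := fun τ hτ ↦
    intervalIntegral.integral_hasDerivAt_right (hint _ hu _ hτ)
      (hcs.stronglyMeasurableAtFilter isOpen_Ioo τ hτ) (hcs.continuousAt (isOpen_Ioo.mem_nhds hτ))
  have hd : ∀ t ∈ Ioo u v, ∃ d, HasDerivAt (S ∘ σ) d t ∧ |d| = speed E η t := by
    intro t ht
    have hn : Icc u v ∈ 𝓝 t := Icc_mem_nhds ht.1 ht.2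
    have hσt := hm (Ioo_subset_Icc_self ht)
    have hγt := hγ.contMDiffAt (isOpen_Ioo.mem_nhds hσt)
    have hev : η =ᶠ[𝓝 t] γ ∘ σ := by filter_upwards [hn] with r hr using he hr
    obtain ⟨r, hr⟩ := exists_hasDerivAt_of_eventuallyEq_comp hγt (h0 _ hσt)
      ((hη.contMDiffAt (isOpen_Ioo.mem_nhds ht)).mdifferentiableAt one_ne_zero)
      (hσ.continuousAt hn) hev
    refine ⟨_, (hS _ hσt).comp t hr, ?_⟩
    rw [speed_congr hev, speed_comp (hγt.mdifferentiableAt one_ne_zero) hr, abs_mul,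
      abs_of_nonneg (speed_nonneg γ _), mul_comm]
  have hderiv : ∀ t ∈ Ioo u v, HasDerivAt (S ∘ σ) (deriv (S ∘ σ) t) t := fun t ht ↦ by
    obtain ⟨d, hd, -⟩ := hd t ht
    rwa [hd.deriv]
  have habs : ∀ t ∈ Ioo u v, ‖deriv (S ∘ σ) t‖ₑ = ENNReal.ofReal (speed E η t) := fun t ht ↦ by
    obtain ⟨d, hd, h⟩ := hd t ht
    rw [hd.deriv, ← h, Real.enorm_eq_ofReal_abs]
  have hlen : ∫⁻ t in Ioc u v, ‖deriv (S ∘ σ) t‖ₑ = pathELength 𝓘(ℝ, E) η u v := by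
    rw [pathELength_eq_lintegral_speed, ← restrict_Ioo_eq_restrict_Ioc,
      ← restrict_Ioo_eq_restrict_Icc]
    exact setLIntegral_congr_fun measurableSet_Ioo habs
  have hInt : IntervalIntegrable (deriv (S ∘ σ)) volume u v := by
    rw [intervalIntegrable_iff_integrableOn_Ioc_of_le huv]
    refine ⟨(measurable_deriv _).aestronglyMeasurable, ?_⟩
    rw [HasFiniteIntegral, hlen]
    exact hfin.lt_top
  have hScont : ContinuousOn S (Ioo a b) := fun τ hτ ↦ (hS τ hτ).continuousAt.continuousWithinAt
  have hFTC := intervalIntegral.integral_eq_sub_of_hasDerivAt_of_le huv (hScont.comp hσ hm)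
    hderiv hInt
  have h1 : ∫ t in u..v, deriv (S ∘ σ) t = ∫ t in σ u..σ v, speed E γ t := by
    rw [hFTC]
    simp [S]
  rw [← h1, ← hlen, intervalIntegral.integral_of_le huv, ← Real.enorm_eq_ofReal_abs]
  exact enorm_integral_le_lintegral_enorm _

end Speed

/-! ### Tangent lines and arcs of leaves. -/

namespace LineFoliation

variable {k : ℕ} {M : Type*} [TopologicalSpace M] [T2Space M]
  [ChartedSpace (EuclideanSpace ℝ (Fin (k + 1))) M] [IsManifold (𝓡 (k + 1)) 1 M]
  (W : LineFoliation k M)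

/-- Near a point, a leafwise curve through a point of a regular leaf curve is a continuous
reparametrization of that regular leaf curve. -/
theorem exists_eventuallyEq_comp {γ η : ℝ → M} {s T : Set ℝ} {t₀ r₀ : ℝ}
    (hγ : IsRegularLeafCurve W.atlas γ s) (hs : IsOpen s) (ht₀ : t₀ ∈ s)
    (hη : IsLeafwise W.atlas η T) (hT : T ∈ 𝓝 r₀) (he : η r₀ = γ t₀) :
    ∃ σ : ℝ → ℝ, ContinuousAt σ r₀ ∧ σ r₀ = t₀ ∧ η =ᶠ[𝓝 r₀] γ ∘ σ := by
  obtain ⟨φ, hφ, hφs⟩ := W.cover (γ t₀)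
  obtain ⟨U, hU, hinj⟩ :=
    exists_injOn_of_mfderiv_ne_zero (hγ.contMDiffAt hs ht₀) (hγ.2.2 t₀ ht₀)
  obtain ⟨δ, hδ, hδU⟩ := Metric.nhds_basis_closedBall.mem_iff.1 (inter_mem hU (hs.mem_nhds ht₀))
  have hev := hγ.eventually_mem_image hs ht₀ (Metric.closedBall_mem_nhds t₀ hδ) hφ hφs hη
    (mem_of_mem_nhds hT) he
  rw [nhdsWithin_eq_nhds.2 hT] at hev
  rw [Real.closedBall_eq_Icc] at hδU hev
  obtain ⟨σ, hσ, hσm, hσe⟩ := exists_continuousOn_comp_eq (γ := γ) (η := η)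
    (T := T ∩ {r | η r ∈ γ '' Icc (t₀ - δ) (t₀ + δ)})
    (hγ.1.1.mono fun t ht ↦ (hδU ht).2) (hinj.mono fun t ht ↦ (hδU ht).1)
    (hη.1.mono inter_subset_left) fun r hr ↦ hr.2
  have hN : T ∩ {r | η r ∈ γ '' Icc (t₀ - δ) (t₀ + δ)} ∈ 𝓝 r₀ := inter_mem hT hev
  refine ⟨σ, hσ.continuousAt hN, ?_, by filter_upwards [hN] with r hr using hσe hr⟩
  refine hinj (hδU (hσm (mem_of_mem_nhds hN))).1 (mem_of_mem_nhds hU) ?_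
  rw [← he]
  exact (hσe (mem_of_mem_nhds hN)).symm

/-- Every other regular leaf curve through the point is locally `γ ∘ σ` with `σ` differentiable
there, so its velocity is a multiple of that of `γ`. -/
theorem tangentLine_eq_span {γ : ℝ → M} {s : Set ℝ} {t₀ : ℝ}
    (hγ : IsRegularLeafCurve W.atlas γ s) (hs : IsOpen s) (ht₀ : t₀ ∈ s) :
    W.tangentLine (γ t₀) =
      Submodule.span ℝ {(mfderiv 𝓘(ℝ, ℝ) (𝓡 (k + 1)) γ t₀ (1 : ℝ) :
        TangentSpace (𝓡 (k + 1)) (γ t₀))} := by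
  apply le_antisymm
  · refine Submodule.span_le.2 ?_
    rintro v ⟨η, ε, hε, h0, hη, rfl⟩
    have hI : Ioo (-ε) ε ∈ 𝓝 (0 : ℝ) := Ioo_mem_nhds (by linarith) hε
    obtain ⟨σ, hσ, hσ0, hσe⟩ := W.exists_eventuallyEq_comp hγ hs ht₀ hη.1 hI h0
    have hγ0 := hγ.contMDiffAt hs ht₀
    have hη0 := hη.contMDiffAt isOpen_Ioo (mem_of_mem_nhds hI)
    subst hσ0
    obtain ⟨r, hr⟩ := exists_hasDerivAt_of_eventuallyEq_comp hγ0 (hγ.2.2 _ ht₀)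
      (hη0.mdifferentiableAt one_ne_zero) hσ hσe
    refine Submodule.mem_span_singleton.2 ⟨r, ?_⟩
    have h1 := mfderiv_comp_one (hγ0.mdifferentiableAt one_ne_zero) hr
    refine h1.symm.trans ?_
    exact congrArg (fun T : ℝ →L[ℝ] EuclideanSpace ℝ (Fin (k + 1)) ↦ T 1)
      (hσe.symm.mfderiv_eq (I := 𝓘(ℝ, ℝ)) (I' := 𝓡 (k + 1)))
  · refine (Submodule.span_singleton_le_iff_mem _ _).2 (Submodule.subset_span ?_)
    obtain ⟨ε, hε, hsub⟩ := Metric.isOpen_iff.1 hs t₀ ht₀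
    have hσ : ∀ r, HasDerivAt (fun r : ℝ ↦ r + t₀) 1 r := fun r ↦ (hasDerivAt_id r).add_const t₀
    have hm : ∀ r ∈ Ioo (-ε) ε, r + t₀ ∈ s := fun r hr ↦ hsub (by
      rw [Metric.mem_ball, Real.dist_eq, add_sub_cancel_right, abs_lt]
      exact hr)
    have hd : ∀ r ∈ Ioo (-ε) ε, mfderiv 𝓘(ℝ, ℝ) (𝓡 (k + 1)) (γ ∘ fun r ↦ r + t₀) r 1 =
        (1 : ℝ) • (mfderiv 𝓘(ℝ, ℝ) (𝓡 (k + 1)) γ (r + t₀) 1) := fun r hr ↦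
      mfderiv_comp_one ((hγ.contMDiffAt hs (hm r hr)).mdifferentiableAt one_ne_zero) (hσ r)
    have h0 : (0 : ℝ) ∈ Ioo (-ε) ε := ⟨by linarith, hε⟩
    refine ⟨γ ∘ fun r ↦ r + t₀, ε, hε, by simp, ⟨hγ.1.comp (by fun_prop) hm, ?_, ?_⟩, ?_⟩
    · refine hγ.2.1.comp (ContDiff.contMDiff ?_).contMDiffOn hm
      fun_prop
    · intro r hr h
      have := hd r hr
      rw [one_smul] at this
      exact hγ.2.2 _ (hm r hr) (this.symm.trans h)
    · have h1 := hd 0 h0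
      rw [one_smul] at h1
      refine Eq.trans ?_ h1.symm
      exact congrArg (fun t ↦ (mfderiv 𝓘(ℝ, ℝ) (𝓡 (k + 1)) γ t 1 : EuclideanSpace ℝ (Fin (k + 1))))
        (zero_add t₀).symm

section Arc

variable [RiemannianBundle (fun x : M ↦ TangentSpace (𝓡 (k + 1)) x)]
  [IsContinuousRiemannianBundle (EuclideanSpace ℝ (Fin (k + 1)))
    (fun x : M ↦ TangentSpace (𝓡 (k + 1)) x)]

/-- A leafwise path that joins an end point of an arc of a leaf to an inner point is at least as
long as one of the two pieces into which the inner point divides the arc. -/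
theorem min_pathELength_le {c η : ℝ → M} {a b p m q : ℝ}
    (hc : IsRegularLeafCurve W.atlas c (Ioo a b)) (hinj : InjOn c (Ioo a b))
    (hp : a < p) (hpm : p < m) (hmq : m < q) (hq : q < b)
    (hη : IsLeafwise W.atlas η (Icc 0 1))
    (hη1 : ContMDiffOn 𝓘(ℝ, ℝ) (𝓡 (k + 1)) 1 η (Icc 0 1)) (h0 : η 0 = c p) (h1 : η 1 = c m) :
    min (pathELength (𝓡 (k + 1)) c p m) (pathELength (𝓡 (k + 1)) c m q) ≤
      pathELength (𝓡 (k + 1)) η 0 1 := by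
  have hsub : Icc p q ⊆ Ioo a b := fun t ht ↦ ⟨hp.trans_le ht.1, ht.2.trans_lt hq⟩
  have hpI : p ∈ Icc p q := left_mem_Icc.2 (hpm.trans hmq).le
  have hqI : q ∈ Icc p q := right_mem_Icc.2 (hpm.trans hmq).le
  have hmI : m ∈ Icc p q := ⟨hpm.le, hmq.le⟩
  have hcc : ContinuousOn c (Icc p q) := hc.1.1.mono hsub
  -- Let `t₁` be the last time at which `η` is at an end of the arc. From then on `η` stays in the
  -- arc and must cover one of the two pieces to reach `c m`.
  have hT : IsCompact (Icc 0 1 ∩ η ⁻¹' {c p, c q}) :=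
    isCompact_Icc.of_isClosed_subset
      (hη.1.preimage_isClosed_of_isClosed isClosed_Icc (by
        rw [Set.insert_eq]; exact isClosed_singleton.union isClosed_singleton)) inter_subset_left
  obtain ⟨t₁, ⟨ht₁, hηt₁⟩, hmax⟩ := hT.exists_isGreatest ⟨0, by simp, by simp [h0]⟩
  have ht₁1 : t₁ < 1 := by
    refine lt_of_le_of_ne ht₁.2 ?_
    rintro rfl
    rcases hηt₁ with h | h <;> rw [h1] at h
    · exact hpm.ne' (hinj (hsub hmI) (hsub hpI) h)
    · exact hmq.ne (hinj (hsub hmI) (hsub hqI) h)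
  have hIoc : Ioc t₁ 1 ⊆ Icc 0 1 := fun t ht ↦ ⟨ht₁.1.trans ht.1.le, ht.2⟩
  -- Being in the arc is an open condition on these times, because the ends are avoided, and a
  -- closed one, because the arc is compact. It holds at time `1`.
  have key : ∀ t ∈ Ioc t₁ 1, η t ∈ c '' Icc p q := by
    intro t ht
    have := isPreconnected_Ioc.induction₂ (s := Ioc t₁ 1)
      (fun r r' ↦ η r ∈ c '' Icc p q ↔ η r' ∈ c '' Icc p q) ?_
      (fun _ _ _ _ _ _ h h' ↦ h.trans h') (fun _ _ _ _ h ↦ h.symm) (right_mem_Ioc.2 ht₁1) ht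
    · exact this.1 ⟨m, hmI, h1.symm⟩
    · intro r hr
      by_cases h : η r ∈ c '' Icc p q
      · obtain ⟨τ, hτ, hτe⟩ := h
        have hnot : η r ∉ ({c p, c q} : Set M) := fun h ↦ hr.1.not_ge (hmax ⟨hIoc hr, h⟩)
        have hτp : p ≠ τ := by rintro rfl; exact hnot (Or.inl hτe.symm)
        have hτq : τ ≠ q := by rintro rfl; exact hnot (Or.inr hτe.symm)
        obtain ⟨φ, hφ, hφs⟩ := W.cover (c τ)
        have hev := hc.eventually_mem_image isOpen_Ioo (hsub hτ)
          (Icc_mem_nhds (lt_of_le_of_ne hτ.1 hτp) (lt_of_le_of_ne hτ.2 hτq)) hφ hφs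
          (hη.mono hIoc) hr hτe.symm
        filter_upwards [hev] with r' hr'
        exact iff_of_true ⟨τ, hτ, hτe⟩ hr'
      · have hcl : IsClosed (c '' Icc p q) := (isCompact_Icc.image_of_continuousOn hcc).isClosed
        filter_upwards [(hη.1 r (hIoc hr)).mono hIoc |>.eventually (hcl.isOpen_compl.mem_nhds h)]
          with r' hr'
        exact iff_of_false h hr'
  have hIcc : Icc t₁ 1 ⊆ Icc 0 1 := Icc_subset_Icc_left ht₁.1
  have key' : MapsTo η (Icc t₁ 1) (c '' Icc p q) := by
    intro t ht
    rcases ht.1.eq_or_lt with rfl | h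
    · rcases hηt₁ with h | h <;> rw [h]
      exacts [mem_image_of_mem c hpI, mem_image_of_mem c hqI]
    · exact key t ⟨h, ht.2⟩
  obtain ⟨σ, hσ, hσm, hσe⟩ := exists_continuousOn_comp_eq hcc (hinj.mono hsub)
    (hη.1.mono hIcc) key'
  have hle := ofReal_abs_integral_speed_le hc.2.1 hc.2.2 ht₁1.le
    (hη1.mono (Ioo_subset_Icc_self.trans hIcc)) hσ (hσm.mono_right hsub) hσe
  have hu : t₁ ∈ Icc t₁ 1 := left_mem_Icc.2 ht₁1.le
  have hv : (1 : ℝ) ∈ Icc t₁ 1 := right_mem_Icc.2 ht₁1.le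
  have hσ1 : σ 1 = m := hinj (hsub (hσm hv)) (hsub hmI) ((hσe hv).symm.trans h1)
  rw [hσ1] at hle
  have hle' := hle.trans (pathELength_mono ht₁.1 le_rfl)
  have hnn : ∀ u v, u ≤ v → 0 ≤ ∫ t in u..v, speed (EuclideanSpace ℝ (Fin (k + 1))) c t :=
    fun u v huv ↦ intervalIntegral.integral_nonneg huv fun t _ ↦ speed_nonneg c t
  rcases hηt₁ with h | h
  · have hσt : σ t₁ = p := hinj (hsub (hσm hu)) (hsub hpI) ((hσe hu).symm.trans h)
    rw [hσt, abs_of_nonneg (hnn _ _ hpm.le),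
      ← pathELength_eq_ofReal_integral hc.2.1 hp hpm.le (hmq.trans hq)] at hle'
    exact (min_le_left _ _).trans hle'
  · have hσt : σ t₁ = q := hinj (hsub (hσm hu)) (hsub hqI) ((hσe hu).symm.trans h)
    rw [hσt, intervalIntegral.integral_symm, abs_neg, abs_of_nonneg (hnn _ _ hmq.le),
      ← pathELength_eq_ofReal_integral hc.2.1 (hp.trans hpm) hmq.le hq] at hle'
    exact (min_le_right _ _).trans hle'

/-- If the points of an arc of a leaf can be joined to one of its end points by leafwise paths of
length at most `B`, then the arc has length at most `2 * B`. -/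
theorem pathELength_le_two_mul {c : ℝ → M} {a b p q : ℝ} {B : ℝ≥0∞}
    (hc : IsRegularLeafCurve W.atlas c (Ioo a b)) (hinj : InjOn c (Ioo a b))
    (hp : a < p) (hpq : p ≤ q) (hq : q < b)
    (hB : ∀ m ∈ Icc p q, ∃ η : ℝ → M, IsLeafwise W.atlas η (Icc 0 1) ∧
      ContMDiffOn 𝓘(ℝ, ℝ) (𝓡 (k + 1)) 1 η (Icc 0 1) ∧ η 0 = c p ∧ η 1 = c m ∧
      pathELength (𝓡 (k + 1)) η 0 1 ≤ B) :
    pathELength (𝓡 (k + 1)) c p q ≤ 2 * B := by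
  set F : ℝ → ℝ := fun m ↦ ∫ t in p..m, speed (EuclideanSpace ℝ (Fin (k + 1))) c t with hF
  have hcs : ContinuousOn (speed (EuclideanSpace ℝ (Fin (k + 1))) c) (Icc p q) :=
    (continuousOn_speed isOpen_Ioo hc.2.1).mono fun t ht ↦ ⟨hp.trans_le ht.1, ht.2.trans_lt hq⟩
  have hFc : ContinuousOn F (Icc p q) := by
    have := intervalIntegral.continuousOn_primitive_interval (a := p) (b := q) (μ := volume)
      (f := speed (EuclideanSpace ℝ (Fin (k + 1))) c)
      (by rw [uIcc_of_le hpq]; exact hcs.integrableOn_Icc)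
    rwa [uIcc_of_le hpq] at this
  have hF0 : F p = 0 := intervalIntegral.integral_same
  have hFq : 0 ≤ F q := intervalIntegral.integral_nonneg hpq fun t _ ↦ speed_nonneg c t
  have hL := pathELength_eq_ofReal_integral hc.2.1 hp hpq hq
  -- At the midpoint in arc length the minimum of the two pieces is half the total.
  obtain ⟨m, hm, hFm⟩ := intermediate_value_Icc hpq hFc
    (show F q / 2 ∈ Icc (F p) (F q) by rw [hF0]; constructor <;> linarith)
  rcases hFq.eq_or_lt with h | h
  · change _ = ENNReal.ofReal (F q) at hL
    rw [hL, ← h, ENNReal.ofReal_zero]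
    exact bot_le
  have hpm : p < m := lt_of_le_of_ne hm.1 (by rintro rfl; linarith)
  have hmq : m < q := lt_of_le_of_ne hm.2 (by rintro rfl; linarith)
  have hl1 : pathELength (𝓡 (k + 1)) c p m = ENNReal.ofReal (F q / 2) := by
    rw [pathELength_eq_ofReal_integral hc.2.1 hp hpm.le (hmq.trans hq), ← hFm]
  have hl2 : pathELength (𝓡 (k + 1)) c m q = ENNReal.ofReal (F q / 2) := by
    rw [pathELength_eq_ofReal_integral hc.2.1 (hp.trans hpm) hmq.le hq]
    congr 1
    have := intervalIntegral.integral_add_adjacent_intervals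
      ((hcs.mono (Icc_subset_Icc_right hm.2)).intervalIntegrable_of_Icc hm.1 (μ := volume))
      ((hcs.mono (Icc_subset_Icc_left hm.1)).intervalIntegrable_of_Icc hm.2)
    change F m + _ = F q at this
    linarith
  obtain ⟨η, hη, hη1, h0, h1, hηB⟩ := hB m hm
  have := W.min_pathELength_le hc hinj hp hpm hmq hq hη hη1 h0 h1
  rw [hl1, hl2, min_self] at this
  rw [← pathELength_add hpm.le hmq.le, hl1, hl2, two_mul]
  exact add_le_add (this.trans hηB) (this.trans hηB)

end Arc

end LineFoliation

/-! ### Homotopy classes with `C¹` representatives of bounded length. -/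

section C1Rep

variable {E : Type*} [NormedAddCommGroup E] [NormedSpace ℝ E]
  {M : Type*} [TopologicalSpace M] [ChartedSpace E M]
  [RiemannianBundle (fun x : M ↦ TangentSpace 𝓘(ℝ, E) x)] {x y z : M}

/-- The homotopy class of paths `α` contains a `C¹` path of length at most `L`. -/
def HasC1Rep (E : Type*) [NormedAddCommGroup E] [NormedSpace ℝ E]
    {M : Type*} [TopologicalSpace M] [ChartedSpace E M]
    [RiemannianBundle (fun x : M ↦ TangentSpace 𝓘(ℝ, E) x)] {x y : M}
    (α : Path.Homotopic.Quotient x y) (L : ℝ≥0∞) : Prop :=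
  ∃ p : Path x y, Path.Homotopic.Quotient.mk p = α ∧
    ContMDiff 𝓘(ℝ, ℝ) 𝓘(ℝ, E) 1 p.extend ∧ pathELength 𝓘(ℝ, E) p.extend 0 1 ≤ L

/-- A `C¹` path can be reparametrized so as to be constant near its end points. -/
theorem exists_flat_path (p : Path x y)
    (hp : ContMDiffOn 𝓘(ℝ, ℝ) 𝓘(ℝ, E) 1 p.extend (Icc 0 1)) :
    ∃ p' : Path x y, p'.Homotopic p ∧ ContMDiff 𝓘(ℝ, ℝ) 𝓘(ℝ, E) 1 p'.extend ∧
      pathELength 𝓘(ℝ, E) p'.extend 0 1 = pathELength 𝓘(ℝ, E) p.extend 0 1 ∧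
      (∀ t ≤ 1 / 4, p'.extend t = x) ∧ ∀ t, 3 / 4 ≤ t → p'.extend t = y := by
  let η : ℝ → ℝ := fun t ↦ Real.smoothTransition (2 * t - 1 / 2)
  have hη0 : ∀ t ≤ 1 / 4, η t = 0 := fun t ht ↦
    Real.smoothTransition.zero_iff_nonpos.2 (by linarith)
  have hη1 : ∀ t, 3 / 4 ≤ t → η t = 1 := fun t ht ↦
    Real.smoothTransition.eq_one_iff_one_le.2 (by linarith)
  have hηI : ∀ t, η t ∈ Icc (0 : ℝ) 1 := fun t ↦
    ⟨Real.smoothTransition.nonneg _, Real.smoothTransition.le_one _⟩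
  have hηs : ContDiff ℝ 1 η := by
    simp only [η]
    fun_prop
  let f : unitInterval → unitInterval := fun t ↦ ⟨η t, hηI t⟩
  have hf : Continuous f := (hηs.continuous.comp continuous_subtype_val).subtype_mk _
  have hf0 : f 0 = 0 := Subtype.ext (hη0 0 (by norm_num))
  have hf1 : f 1 = 1 := Subtype.ext (hη1 1 (by norm_num))
  have hext : (p.reparam f hf hf0 hf1).extend = p.extend ∘ η := by
    funext t
    rcases le_total t 0 with h | h
    · rw [Path.extend_of_le_zero _ h, Function.comp_apply, hη0 t (by linarith), Path.extend_zero]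
    rcases le_total 1 t with h' | h'
    · rw [Path.extend_of_one_le _ h', Function.comp_apply, hη1 t (by linarith), Path.extend_one]
    rw [Path.extend_apply _ ⟨h, h'⟩, Function.comp_apply, Path.extend_apply _ (hηI t)]
    rfl
  refine ⟨p.reparam f hf hf0 hf1, ⟨(Path.Homotopy.reparam p f hf hf0 hf1).symm⟩, ?_, ?_, ?_, ?_⟩
  · rw [hext, ← contMDiffOn_univ]
    exact hp.comp hηs.contMDiff.contMDiffOn fun t _ ↦ hηI t
  · have h0 := hη0 0 (by norm_num)
    have h1 := hη1 1 (by norm_num)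
    have := pathELength_comp_of_monotoneOn (I := 𝓘(ℝ, E)) (γ := p.extend) (f := η) zero_le_one
      (Monotone.monotoneOn (fun s t hst ↦ Real.smoothTransition.monotone (by linarith)) _)
      (hηs.differentiable one_ne_zero).differentiableOn
      (by rw [h0, h1]; exact hp.mdifferentiableOn one_ne_zero)
    rw [h0, h1] at this
    rw [hext, this]
  · intro t ht
    rw [hext, Function.comp_apply, hη0 t ht, Path.extend_zero]
  · intro t ht
    rw [hext, Function.comp_apply, hη1 t ht, Path.extend_one]

theorem hasC1Rep_mk (p : Path x y)
    (hp : ContMDiffOn 𝓘(ℝ, ℝ) 𝓘(ℝ, E) 1 p.extend (Icc 0 1)) :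
    HasC1Rep E (Path.Homotopic.Quotient.mk p) (pathELength 𝓘(ℝ, E) p.extend 0 1) := by
  obtain ⟨p', h, hs, hl, -⟩ := exists_flat_path p hp
  exact ⟨p', Path.Homotopic.Quotient.eq.2 h, hs, hl.le⟩

theorem HasC1Rep.mono {α : Path.Homotopic.Quotient x y} {L L' : ℝ≥0∞} (h : HasC1Rep E α L)
    (hL : L ≤ L') : HasC1Rep E α L' := by
  obtain ⟨p, h1, h2, h3⟩ := h
  exact ⟨p, h1, h2, h3.trans hL⟩

theorem hasC1Rep_refl (x : M) : HasC1Rep E (Path.Homotopic.Quotient.refl x) 0 := by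
  refine ⟨Path.refl x, rfl, ?_, ?_⟩
  · rw [Path.refl_extend]
    exact contMDiff_const
  · have : pathELength 𝓘(ℝ, E) (fun _ : ℝ ↦ x) 0 1 = 0 := by
      rw [pathELength_eq_lintegral_mfderiv_Icc]
      simp [mfderiv_const]
    rw [Path.refl_extend]
    exact this.le

theorem HasC1Rep.symm {α : Path.Homotopic.Quotient x y} {L : ℝ≥0∞} (h : HasC1Rep E α L) :
    HasC1Rep E α.symm L := by
  obtain ⟨p, rfl, hs, hl⟩ := h
  have hσ : ContDiff ℝ 1 fun t : ℝ ↦ 1 - t := by fun_prop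
  refine ⟨p.symm, rfl, ?_, ?_⟩
  · rw [Path.extend_symm]
    exact hs.comp hσ.contMDiff
  · have := pathELength_comp_of_antitoneOn (I := 𝓘(ℝ, E)) (γ := p.extend) (f := fun t ↦ 1 - t)
      zero_le_one (Antitone.antitoneOn (fun s t hst ↦ by linarith) _)
      (hσ.differentiable one_ne_zero).differentiableOn (hs.mdifferentiable one_ne_zero).mdifferentiableOn
    simp only [sub_self, sub_zero] at this
    rw [Path.extend_symm]
    exact this.le.trans hl

/-- A concatenation has a corner in general. Making both paths constant near the junction removes it
and changes neither the lengths nor the classes. -/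
theorem HasC1Rep.trans {α : Path.Homotopic.Quotient x y} {β : Path.Homotopic.Quotient y z}
    {L L' : ℝ≥0∞} (hα : HasC1Rep E α L) (hβ : HasC1Rep E β L') :
    HasC1Rep E (α.trans β) (L + L') := by
  obtain ⟨p₀, rfl, hps₀, hpl₀⟩ := hα
  obtain ⟨q₀, rfl, hqs₀, hql₀⟩ := hβ
  obtain ⟨p, hp, hps, hpl, -, hp1⟩ := exists_flat_path p₀ hps₀.contMDiffOn
  obtain ⟨q, hq, hqs, hql, hq0, -⟩ := exists_flat_path q₀ hqs₀.contMDiffOn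
  rw [← Path.Homotopic.Quotient.eq] at hp hq
  rw [← hp, ← hq, ← Path.Homotopic.Quotient.mk_trans]
  have hσ : ContDiff ℝ 1 fun t : ℝ ↦ 2 * t := by fun_prop
  have hτ : ContDiff ℝ 1 fun t : ℝ ↦ 2 * t - 1 := by fun_prop
  have hext : ((p.trans q).extend : ℝ → M) =
      Set.piecewise (Iic (1 / 2 : ℝ)) (p.extend ∘ fun t ↦ 2 * t) (q.extend ∘ fun t ↦ 2 * t - 1) := by
    funext t
    by_cases h : t ≤ 1 / 2
    · rw [Path.extend_trans_of_le_half _ _ h, piecewise_eq_of_mem _ _ _ (mem_Iic.2 h), Function.comp_apply]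
    · rw [Path.extend_trans_of_half_le _ _ (not_le.1 h).le,
        piecewise_eq_of_notMem _ _ _ (by simpa using h), Function.comp_apply]
  refine ⟨p.trans q, rfl, ?_, ?_⟩
  · rw [hext]
    refine ContMDiff.piecewise_Iic (hps.comp hσ.contMDiff) (hqs.comp hτ.contMDiff) ?_
    -- On `[3/8, 5/8]` we have `2t ≥ 3/4` and `2t - 1 ≤ 1/4`, so both formulas give the common end
    -- point.
    filter_upwards [Icc_mem_nhds (show (3 / 8 : ℝ) < 1 / 2 by norm_num)
      (show (1 / 2 : ℝ) < 5 / 8 by norm_num)] with t ht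
    rw [Function.comp_apply, Function.comp_apply, hp1 _ (by linarith [ht.1]),
      hq0 _ (by linarith [ht.2])]
  · rw [← pathELength_add (show (0 : ℝ) ≤ 1 / 2 by norm_num) (show (1 / 2 : ℝ) ≤ 1 by norm_num)]
    refine add_le_add (le_trans (le_of_eq ?_) hpl₀) (le_trans (le_of_eq ?_) hql₀)
    · rw [← hpl, pathELength_congr (γ' := p.extend ∘ fun t ↦ 2 * t) fun t ht ↦
        Path.extend_trans_of_le_half _ _ ht.2,
        pathELength_comp_of_monotoneOn (by norm_num)
          (Monotone.monotoneOn (fun s t hst ↦ by linarith) _)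
          (hσ.differentiable one_ne_zero).differentiableOn
          (hps.mdifferentiable one_ne_zero).mdifferentiableOn]
      norm_num
    · rw [← hql, pathELength_congr (γ' := q.extend ∘ fun t ↦ 2 * t - 1) fun t ht ↦
        Path.extend_trans_of_half_le _ _ ht.1,
        pathELength_comp_of_monotoneOn (by norm_num)
          (Monotone.monotoneOn (fun s t hst ↦ by linarith) _)
          (hτ.differentiable one_ne_zero).differentiableOn
          (hqs.mdifferentiable one_ne_zero).mdifferentiableOn]
      norm_num

/-- Points at Riemannian distance less than `r` are joined by `C¹` paths of length less than `r`
which stay at distance less than `r` from their starting point. -/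
theorem exists_path_of_riemannianEDist_lt {r : ℝ≥0∞} (h : riemannianEDist 𝓘(ℝ, E) x y < r) :
    ∃ p : Path x y, HasC1Rep E (Path.Homotopic.Quotient.mk p) r ∧
      ∀ t, riemannianEDist 𝓘(ℝ, E) x (p t) < r := by
  obtain ⟨γ, h0, h1, hs, hl⟩ := exists_lt_of_riemannianEDist_lt h
  let p : Path x y := ⟨⟨fun t ↦ γ t, hs.continuousOn.domRestrict⟩, h0, h1⟩
  have hext : EqOn p.extend γ (Icc 0 1) := fun t ht ↦ Path.extend_apply p ht
  refine ⟨p, (hasC1Rep_mk p (hs.congr hext)).mono ?_, fun t ↦ ?_⟩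
  · rw [pathELength_congr hext]
    exact hl.le
  · exact (riemannianEDist_le_pathELength (hs.mono (Icc_subset_Icc_right t.2.2)) h0 rfl t.2.1).trans_lt
      ((pathELength_mono le_rfl t.2.2).trans_lt hl)

end C1Rep

/-! ### Small paths are homotopic; every class has a representative of finite length. -/

section LocallySimplyConnected

variable {E : Type*} [NormedAddCommGroup E] [NormedSpace ℝ E]
  {M : Type*} [TopologicalSpace M] [ChartedSpace E M]

/-- The preimage of a ball under a chart is a copy of a convex, hence simply connected, set. -/
theorem exists_nhds_forall_homotopic (E : Type*) [NormedAddCommGroup E] [NormedSpace ℝ E]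
    {M : Type*} [TopologicalSpace M] [ChartedSpace E M] (x : M) :
    ∃ U, IsOpen U ∧ x ∈ U ∧ ∀ (y z : M) (p q : Path y z), (∀ t, p t ∈ U) → (∀ t, q t ∈ U) →
      p.Homotopic q := by
  let e := chartAt E x
  obtain ⟨r, hr, hball⟩ := Metric.isOpen_iff.1 e.open_target (e x) (mem_chart_target E x)
  let B := Metric.ball (e x) r
  refine ⟨e.source ∩ e ⁻¹' B, e.isOpen_inter_preimage Metric.isOpen_ball,
    ⟨mem_chart_source E x, Metric.mem_ball_self hr⟩, ?_⟩
  intro y z p q hp hq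
  have : ContractibleSpace B := (convex_ball (e x) r).contractibleSpace ⟨e x, Metric.mem_ball_self hr⟩
  let ψ : C(B, M) := ⟨fun b ↦ e.symm b, e.continuousOn_symm.comp_continuous
    continuous_subtype_val fun b ↦ hball b.2⟩
  have hψ : ∀ w (hw : w ∈ e.source ∩ e ⁻¹' B), ψ ⟨e w, hw.2⟩ = w := fun w hw ↦ e.left_inv hw.1
  have hyU : y ∈ e.source ∩ e ⁻¹' B := by simpa using hp 0
  have hzU : z ∈ e.source ∩ e ⁻¹' B := by simpa using hp 1
  have lift : ∀ p : Path y z, (∀ t, p t ∈ e.source ∩ e ⁻¹' B) →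
      ∃ p' : Path (⟨e y, hyU.2⟩ : B) ⟨e z, hzU.2⟩,
        (p'.map ψ.continuous).cast (hψ y hyU).symm (hψ z hzU).symm = p := by
    intro p hp
    refine ⟨⟨⟨fun t ↦ ⟨e (p t), (hp t).2⟩, ?_⟩, ?_, ?_⟩, ?_⟩
    · exact (e.continuousOn.comp_continuous p.continuous fun t ↦ (hp t).1).subtype_mk _
    · exact Subtype.ext (congrArg e p.source)
    · exact Subtype.ext (congrArg e p.target)
    · ext t
      exact hψ (p t) (hp t)
  obtain ⟨p', rfl⟩ := lift p hp
  obtain ⟨q', rfl⟩ := lift q hq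
  exact ((SimplyConnectedSpace.paths_homotopic p' q').map ψ).pathCast _ _

variable [CompactSpace M] [RegularSpace M] [IsManifold 𝓘(ℝ, E) 1 M]
  [RiemannianBundle (fun x : M ↦ TangentSpace 𝓘(ℝ, E) x)]
  [IsContinuousRiemannianBundle E (fun x : M ↦ TangentSpace 𝓘(ℝ, E) x)]

variable (E M) in
/-- On a compact Riemannian manifold, paths with the same end points in a ball of small uniform
radius are homotopic. -/
theorem exists_pos_forall_homotopic :
    ∃ ε > 0, ∀ (x y z : M) (p q : Path y z), (∀ t, riemannianEDist 𝓘(ℝ, E) x (p t) < ε) →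
      (∀ t, riemannianEDist 𝓘(ℝ, E) x (q t) < ε) → p.Homotopic q := by
  let : PseudoEMetricSpace M := .ofRiemannianMetric 𝓘(ℝ, E) M
  choose U hUo hxU hU using exists_nhds_forall_homotopic E (M := M)
  obtain ⟨ε, hε, h⟩ := lebesgue_number_lemma_of_emetric isCompact_univ hUo
    (fun x _ ↦ mem_iUnion.2 ⟨x, hxU x⟩)
  refine ⟨ε, hε, fun x y z p q hp hq ↦ ?_⟩
  obtain ⟨i, hi⟩ := h x (mem_univ x)
  have hb : ∀ w, riemannianEDist 𝓘(ℝ, E) x w < ε → w ∈ U i := fun w hw ↦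
    hi (Metric.mem_eball'.2 hw)
  exact hU i y z p q (fun t ↦ hb _ (hp t)) fun t ↦ hb _ (hq t)

end LocallySimplyConnected

section Arc

variable {X : Type*} [TopologicalSpace X]

/-- The homotopy class of the arc of a curve between two parameters. -/
def arcClass (c : C(ℝ, X)) (s t : ℝ) : Path.Homotopic.Quotient (c s) (c t) :=
  (Path.Homotopic.Quotient.mk (Path.segment s t)).map c

/-- `ℝ` is simply connected, so there is just one class of paths between two parameters. -/
theorem arcClass_trans (c : C(ℝ, X)) (s t u : ℝ) :
    (arcClass c s t).trans (arcClass c t u) = arcClass c s u := by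
  have : (Path.Homotopic.Quotient.mk (Path.segment s t)).trans (.mk (Path.segment t u)) =
      .mk (Path.segment s u) := Subsingleton.elim _ _
  rw [arcClass, arcClass, arcClass, ← this]
  exact (Path.Homotopic.Quotient.mk_map ..).symm.trans (by rw [Path.map_trans]; rfl) |>.symm

theorem arcClass_symm (c : C(ℝ, X)) (s t : ℝ) : (arcClass c s t).symm = arcClass c t s := by
  have : (Path.Homotopic.Quotient.mk (Path.segment s t)).symm = .mk (Path.segment t s) :=
    Subsingleton.elim _ _
  rw [arcClass, arcClass, ← this]
  rfl

end Arc

section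

variable {E : Type*} [NormedAddCommGroup E] [NormedSpace ℝ E]
  {M : Type*} [TopologicalSpace M] [ChartedSpace E M]
  [CompactSpace M] [RegularSpace M] [IsManifold 𝓘(ℝ, E) 1 M]
  [RiemannianBundle (fun x : M ↦ TangentSpace 𝓘(ℝ, E) x)]
  [IsContinuousRiemannianBundle E (fun x : M ↦ TangentSpace 𝓘(ℝ, E) x)]

/-- For nearby parameters the arc is homotopic to a short `C¹` path, as both lie in a small ball.
The property is symmetric and transitive, so connectedness of `ℝ` propagates it. -/
theorem exists_hasC1Rep_arcClass (c : C(ℝ, M)) (s t : ℝ) :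
    ∃ L ≠ ⊤, HasC1Rep E (arcClass c s t) L := by
  obtain ⟨ε₀, hε₀, H⟩ := exists_pos_forall_homotopic E M
  obtain ⟨ε, hε, hεε⟩ := ENNReal.lt_iff_exists_nnreal_btwn.1 hε₀
  refine isPreconnected_univ.induction₂ (fun s t ↦ ∃ L ≠ ⊤, HasC1Rep E (arcClass c s t) L) ?_
    ?_ ?_ (mem_univ s) (mem_univ t)
  · intro s _
    rw [nhdsWithin_univ]
    obtain ⟨δ, hδ, hsub⟩ := Metric.mem_nhds_iff.1
      (c.continuous.continuousAt.eventually (eventually_riemannianEDist_lt 𝓘(ℝ, E) (c s) hε))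
    filter_upwards [Metric.ball_mem_nhds s hδ] with t ht
    obtain ⟨p, hp, hpε⟩ := exists_path_of_riemannianEDist_lt (hsub ht)
    refine ⟨ε, ENNReal.coe_ne_top, ?_⟩
    have : Path.Homotopic.Quotient.mk p = arcClass c s t := by
      refine Path.Homotopic.Quotient.eq.2 (H (c s) _ _ _ ((Path.segment s t).map c.continuous)
        (fun t ↦ (hpε t).trans hεε) fun r ↦ lt_trans (hsub ?_) hεε)
      exact (convex_ball s δ).segment_subset (Metric.mem_ball_self hδ) ht
        (by rw [segment_eq_image_lineMap]; exact ⟨r, r.2, rfl⟩)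
    rw [← this]
    exact hp
  · rintro s t u - - - ⟨L, hL, h⟩ ⟨L', hL', h'⟩
    exact ⟨L + L', ENNReal.add_ne_top.2 ⟨hL, hL'⟩, arcClass_trans c s t u ▸ h.trans h'⟩
  · rintro s t - - ⟨L, hL, h⟩
    exact ⟨L, hL, arcClass_symm c s t ▸ h.symm⟩

theorem exists_hasC1Rep {x y : M} (α : Path.Homotopic.Quotient x y) :
    ∃ L ≠ ⊤, HasC1Rep E α L := by
  obtain ⟨p, rfl⟩ := Path.Homotopic.Quotient.mk_surjective α
  let c : C(ℝ, M) := p.extend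
  have hc0 : x = c 0 := p.extend_zero.symm
  have hc1 : y = c 1 := p.extend_one.symm
  obtain ⟨L, hL, h⟩ := exists_hasC1Rep_arcClass (E := E) c 0 1
  refine ⟨L, hL, ?_⟩
  -- The end points are generalized so that the casts can be eliminated by substitution.
  have key : ∀ (x' y' : M) (hx : x' = c 0) (hy : y' = c 1),
      HasC1Rep E ((arcClass c 0 1).cast hx hy) L := by
    rintro _ _ rfl rfl
    simpa using h
  have hp : (arcClass c 0 1).cast hc0 hc1 = Path.Homotopic.Quotient.mk p := by
    have : ((Path.segment (0 : ℝ) 1).map c.continuous).cast hc0 hc1 = p := by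
      ext t
      simp [c, Path.segment, AffineMap.lineMap_apply]
    rw [← this]
    rfl
  rw [← hp]
  exact key x y hc0 hc1

end

/-! ### Words, path classes and the action of a homeomorphism on the fundamental group. -/

theorem exists_list_length_eq_wordLength {G : Type*} [Group G] {S : Finset G}
    (hS : Subgroup.closure (S : Set G) = ⊤) (g : G) :
    ∃ l : List G, l.length = wordLength S g ∧ (∀ s ∈ l, s ∈ S ∨ s⁻¹ ∈ S) ∧ l.prod = g := by
  refine Nat.sInf_mem (s := {n : ℕ | ∃ l : List G, l.length = n ∧ (∀ s ∈ l, s ∈ S ∨ s⁻¹ ∈ S) ∧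
    l.prod = g}) ?_
  have hg : g ∈ Submonoid.closure ((S : Set G) ∪ (S : Set G)⁻¹) := by
    rw [← Subgroup.closure_toSubmonoid, hS]
    trivial
  obtain ⟨l, hl, hlg⟩ := Submonoid.exists_list_of_mem_closure hg
  exact ⟨l.length, l, rfl, fun s hs ↦ by simpa using hl s hs, hlg⟩

namespace Path.Homotopic.Quotient

variable {X Y : Type*} [TopologicalSpace X] [TopologicalSpace Y] {x y z : X}

theorem symm_trans_trans (α : Path.Homotopic.Quotient x y) (β : Path.Homotopic.Quotient y z) :
    (α.trans β).symm = β.symm.trans α.symm := by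
  induction α, β using Path.Homotopic.Quotient.ind₂ with | _ p q
  rw [← mk_trans, ← mk_symm, ← mk_symm, ← mk_symm, ← mk_trans, Path.trans_symm]

theorem symm_symm (α : Path.Homotopic.Quotient x y) : α.symm.symm = α := by
  induction α using Path.Homotopic.Quotient.ind with | _ p
  rw [← mk_symm, ← mk_symm, Path.symm_symm]

theorem map_trans (α : Path.Homotopic.Quotient x y) (β : Path.Homotopic.Quotient y z)
    (f : C(X, Y)) : (α.trans β).map f = (α.map f).trans (β.map f) := by
  induction α, β using Path.Homotopic.Quotient.ind₂ with | _ p q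
  rw [← mk_trans, ← mk_map, ← mk_map, ← mk_map, ← mk_trans, Path.map_trans]

theorem map_symm (α : Path.Homotopic.Quotient x y) (f : C(X, Y)) :
    α.symm.map f = (α.map f).symm := by
  induction α using Path.Homotopic.Quotient.ind with | _ p
  rw [← mk_symm, ← mk_map, ← mk_map, ← mk_symm]
  rfl

theorem symm_trans_cancel_left (α : Path.Homotopic.Quotient x y)
    (β : Path.Homotopic.Quotient y z) : α.symm.trans (α.trans β) = β := by
  rw [← trans_assoc, symm_trans, refl_trans]

theorem trans_symm_cancel_left (α : Path.Homotopic.Quotient x y)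
    (β : Path.Homotopic.Quotient x z) : α.trans (α.symm.trans β) = β := by
  rw [← trans_assoc, trans_symm, refl_trans]

theorem map_homeomorph_bijective (f : X ≃ₜ Y) (x y : X) :
    Function.Bijective fun α : Path.Homotopic.Quotient x y ↦ α.map (f : C(X, Y)) := by
  constructor
  · intro α β h
    induction α, β using Path.Homotopic.Quotient.ind₂ with | _ p q
    have h1 : (p.map f.continuous).Homotopic (q.map f.continuous) := Path.Homotopic.Quotient.eq.1 h
    have h2 := (h1.map (f.symm : C(Y, X))).pathCast (f.symm_apply_apply x).symm
      (f.symm_apply_apply y).symm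
    have key : ∀ p : Path x y, ((p.map f.continuous).map f.symm.continuous).cast
        (f.symm_apply_apply x).symm (f.symm_apply_apply y).symm = p := fun p ↦ by ext t; simp
    rw [← key p, ← key q]
    exact Path.Homotopic.Quotient.eq.2 h2
  · intro β
    induction β using Path.Homotopic.Quotient.ind with | _ p
    refine ⟨.mk ((p.map f.symm.continuous).cast (f.symm_apply_apply x).symm
      (f.symm_apply_apply y).symm), ?_⟩
    have key : ((p.map f.symm.continuous).cast (f.symm_apply_apply x).symm
      (f.symm_apply_apply y).symm).map f.continuous = p := by ext t; simp
    exact congrArg mk key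

end Path.Homotopic.Quotient

section Growth

open Path

variable {X : Type*} [TopologicalSpace X] {x₀ : X}

/-- The automorphism of the fundamental group induced by a homeomorphism and a path from the base
point to its image. -/
noncomputable def fundamentalGroupAut (f : X ≃ₜ X) (δ : Homotopic.Quotient x₀ (f x₀)) :
    FundamentalGroup X x₀ ≃* FundamentalGroup X x₀ :=
  MulEquiv.ofBijective
    (⟨fun g ↦ (δ.trans ((Homotopic.Quotient.map g (f : C(X, X))).trans δ.symm) : Homotopic.Quotient x₀ x₀), by
      intro g h
      rw [FundamentalGroup.mul_def, FundamentalGroup.mul_def]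
      simp only [Homotopic.Quotient.map_trans, Homotopic.Quotient.trans_assoc, Homotopic.Quotient.symm_trans_cancel_left]⟩ :
      FundamentalGroup X x₀ →ₙ* FundamentalGroup X x₀) (by
    constructor
    · intro g h hgh
      have hgh' : δ.trans ((Homotopic.Quotient.map g (f : C(X, X))).trans δ.symm) =
        δ.trans ((Homotopic.Quotient.map h (f : C(X, X))).trans δ.symm) := hgh
      have h1 := congrArg (fun α ↦ (δ.symm.trans α).trans δ) hgh'
      simp only [Homotopic.Quotient.symm_trans_cancel_left, Homotopic.Quotient.trans_assoc, Homotopic.Quotient.symm_trans,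
        Homotopic.Quotient.trans_refl] at h1
      exact (Homotopic.Quotient.map_homeomorph_bijective f x₀ x₀).1 h1
    · intro g
      obtain ⟨α, hα⟩ := (Homotopic.Quotient.map_homeomorph_bijective f x₀ x₀).2
        (δ.symm.trans (Homotopic.Quotient.trans g δ))
      refine ⟨α, ?_⟩
      change δ.trans ((Homotopic.Quotient.map α (f : C(X, X))).trans δ.symm) = _
      have hα' : Homotopic.Quotient.map α (f : C(X, X)) = δ.symm.trans (Homotopic.Quotient.trans g δ) := hα
      rw [hα']
      simp only [Homotopic.Quotient.trans_assoc, Homotopic.Quotient.trans_symm_cancel_left, Homotopic.Quotient.trans_symm,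
        Homotopic.Quotient.trans_refl])

/-- The images of a curve under the iterates of a map. -/
def iterCurve (f : C(X, X)) (γ : C(ℝ, X)) : ℕ → C(ℝ, X)
  | 0 => γ
  | n + 1 => f.comp (iterCurve f γ n)

theorem iterCurve_apply (f : C(X, X)) (γ : C(ℝ, X)) (n : ℕ) (t : ℝ) :
    iterCurve f γ n t = f^[n] (γ t) := by
  induction n with
  | zero => rfl
  | succ n ih => rw [Function.iterate_succ_apply', ← ih]; rfl

/-- The action of the lift of `f` to the universal cover on a curve of homotopy classes of paths
that start at the base point. -/
noncomputable def iterClass (f : C(X, X)) (γ : C(ℝ, X)) (δ : Homotopic.Quotient x₀ (f x₀))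
    (α : ∀ t, Homotopic.Quotient x₀ (γ t)) : ∀ n t, Homotopic.Quotient x₀ (iterCurve f γ n t)
  | 0, t => α t
  | n + 1, t => δ.trans ((iterClass f γ δ α n t).map f)

/-- If the classes at time `0` form a lift of the curve, so do their iterates: mapping by `f` and
prefixing `δ` commutes with appending an arc. -/
theorem iterClass_trans_arcClass {f : C(X, X)} {γ : C(ℝ, X)} (δ : Homotopic.Quotient x₀ (f x₀))
    {α : ∀ t, Homotopic.Quotient x₀ (γ t)} (hα : ∀ s t, (α s).trans (arcClass γ s t) = α t)
    (n : ℕ) (s t : ℝ) :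
    (iterClass f γ δ α n s).trans (arcClass (iterCurve f γ n) s t) = iterClass f γ δ α n t := by
  induction n with
  | zero => exact hα s t
  | succ n ih =>
    change (δ.trans ((iterClass f γ δ α n s).map f)).trans
      ((arcClass (iterCurve f γ n) s t).map f) = δ.trans ((iterClass f γ δ α n t).map f)
    rw [← ih, Homotopic.Quotient.map_trans, Homotopic.Quotient.trans_assoc]

/-- The sequence of homotopy classes of loops traced by a curve of classes under the iterates of a
homeomorphism stays in a sequence `A_{k+1} = U_N(φ(A_k))`. -/
theorem exists_stretchSeq {S : Finset (FundamentalGroup X x₀)} (f : X ≃ₜ X) (γ : C(ℝ, X))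
    (δ : Homotopic.Quotient x₀ (f x₀)) (α : ∀ t, Homotopic.Quotient x₀ (γ t)) (β : ∀ x : X, Homotopic.Quotient x₀ x) (I : Set ℝ)
    (hA : ((fun t ↦ (β (γ t)).trans (α t).symm) '' I).Finite)
    (hN : (range fun x ↦
      (β (f x)).trans (((β x).map (f : C(X, X))).symm.trans δ.symm)).Finite) :
    ∃ (φ : FundamentalGroup X x₀ ≃* FundamentalGroup X x₀) (N : ℕ) (_ : 0 < N)
      (A₀ : Set (FundamentalGroup X x₀)) (_ : A₀.Finite), ∀ n, ∀ t ∈ I,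
        (β (iterCurve f γ n t)).trans (iterClass (f : C(X, X)) γ δ α n t).symm ∈
          stretchSeq S φ N A₀ n := by
  -- `N` bounds the word lengths of the finitely many error loops; passing to `N + 1` makes the
  -- radius positive.
  obtain ⟨N, hN⟩ := (hN.image fun g : Homotopic.Quotient x₀ x₀ ↦
    wordLength S (FundamentalGroup.fromPath g)).bddAbove
  refine ⟨fundamentalGroupAut f δ, N + 1, N.succ_pos, _, hA, fun n t ht ↦ ?_⟩
  induction n with
  | zero => exact ⟨t, ht, rfl⟩
  | succ n ih =>
    refine ⟨_, mem_image_of_mem _ ih, ?_⟩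
    let F : C(X, X) := f
    let x : X := iterCurve F γ n t
    let a : Homotopic.Quotient x₀ x := iterClass F γ δ α n t
    let e : Homotopic.Quotient x₀ x₀ := (β (f x)).trans (((β x).map F).symm.trans δ.symm)
    let b : Homotopic.Quotient x₀ (f x) := δ.trans (a.map F)
    have h1 : (β (f x)).trans b.symm =
        e.trans (δ.trans (((β x).trans a.symm).map F |>.trans δ.symm)) := by
      simp only [e, b, Homotopic.Quotient.map_trans, Homotopic.Quotient.map_symm,
        Homotopic.Quotient.trans_assoc, Homotopic.Quotient.symm_trans_cancel_left,
        Homotopic.Quotient.symm_trans_trans]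
    -- Multiplication in `FundamentalGroup` reverses concatenation, so the error loop `e`, which is
    -- run first, is a right factor. The left-invariant `wordDist` then equals the word length of
    -- `e`.
    have h2 : FundamentalGroup.fromPath ((β (f x)).trans b.symm) =
        fundamentalGroupAut f δ (FundamentalGroup.fromPath ((β x).trans a.symm)) *
          FundamentalGroup.fromPath e := h1
    have h3 : wordDist S (fundamentalGroupAut f δ (FundamentalGroup.fromPath ((β x).trans a.symm)))
        (FundamentalGroup.fromPath ((β (f x)).trans b.symm)) ≤ N + 1 := by
      rw [h2, wordDist, inv_mul_cancel_left]
      exact (hN ⟨e, ⟨_, rfl⟩, rfl⟩).trans N.le_succ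
    exact h3

end Growth

/-! ### Polynomial length of the homotopy classes of iterated arcs. -/

theorem Set.Finite.image_of_forall_eq {ι κ Y : Type*} {I : Set ι} {t : Set κ} (ht : t.Finite)
    {l : ι → κ} (hl : MapsTo l I t) {e : ι → Y}
    (h : ∀ i ∈ I, ∀ j ∈ I, l i = l j → e i = e j) : (e '' I).Finite := by
  have hsub : e '' I ⊆ ⋃ z ∈ t, e '' (I ∩ l ⁻¹' {z}) := by
    rintro _ ⟨i, hi, rfl⟩
    exact mem_iUnion₂.2 ⟨l i, hl hi, i, ⟨hi, rfl⟩, rfl⟩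
  refine (ht.biUnion fun z _ ↦ Set.Subsingleton.finite ?_).subset hsub
  rintro _ ⟨i, ⟨hi, hiz⟩, rfl⟩ _ ⟨j, ⟨hj, hjz⟩, rfl⟩
  exact h i hi j hj (Eq.trans hiz (Eq.symm hjz))

section

variable {E : Type*} [NormedAddCommGroup E] [NormedSpace ℝ E]
  {M : Type*} [TopologicalSpace M] [ChartedSpace E M]
  [RiemannianBundle (fun x : M ↦ TangentSpace 𝓘(ℝ, E) x)]

open Path

theorem hasC1Rep_list_prod {x₀ : M} {Λ : ℝ≥0∞} (l : List (FundamentalGroup M x₀))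
    (hl : ∀ g ∈ l, HasC1Rep E (FundamentalGroup.toPath g) Λ) :
    HasC1Rep E (FundamentalGroup.toPath l.prod) (l.length * Λ) := by
  induction l with
  | nil =>
    rw [List.prod_nil, FundamentalGroup.one_def]
    simpa using hasC1Rep_refl (E := E) x₀
  | cons g l ih =>
    rw [List.prod_cons, FundamentalGroup.mul_def, List.length_cons, Nat.cast_add, Nat.cast_one,
      add_mul, one_mul]
    exact (ih fun g hg ↦ hl g (List.mem_cons_of_mem _ hg)).trans (hl g List.mem_cons_self)

variable [CompactSpace M] [RegularSpace M] [IsManifold 𝓘(ℝ, E) 1 M]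
  [IsContinuousRiemannianBundle E (fun x : M ↦ TangentSpace 𝓘(ℝ, E) x)]

/-- `Λ` is the sum of the lengths of representatives of the finitely many generators; inverse
letters are the same paths run backwards. -/
theorem exists_hasC1Rep_wordLength {x₀ : M} {S : Finset (FundamentalGroup M x₀)}
    (hS : Subgroup.closure (S : Set (FundamentalGroup M x₀)) = ⊤) :
    ∃ Λ : ℝ≥0, ∀ g : FundamentalGroup M x₀,
      HasC1Rep E (FundamentalGroup.toPath g) (wordLength S g * Λ) := by
  choose L hL hLr using fun g : FundamentalGroup M x₀ ↦
    exists_hasC1Rep (E := E) (FundamentalGroup.toPath g)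
  have hfin : ∑ g ∈ S, L g ≠ ⊤ := ENNReal.sum_ne_top.2 fun g _ ↦ hL g
  refine ⟨(∑ g ∈ S, L g).toNNReal, fun g ↦ ?_⟩
  rw [ENNReal.coe_toNNReal hfin]
  obtain ⟨l, hlen, hl, rfl⟩ := exists_list_length_eq_wordLength hS g
  rw [← hlen]
  refine hasC1Rep_list_prod l fun g hg ↦ ?_
  rcases hl g hg with h | h
  · exact (hLr g).mono (Finset.single_le_sum (f := L) (fun _ _ ↦ bot_le) h)
  · have h1 := ((hLr g⁻¹).mono (Finset.single_le_sum (f := L) (fun _ _ ↦ bot_le) h)).symm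
    rw [← FundamentalGroup.inv_def, inv_inv] at h1
    exact h1

/-- The arcs of the images of a short curve under the iterates of a homeomorphism are homotopic to
`C¹` paths of polynomially bounded length if the fundamental group is unstretchable. -/
theorem exists_polynomial_hasC1Rep [PathConnectedSpace M] {x₀ : M}
    (hG : IsUnstretchable (FundamentalGroup M x₀)) (f : M ≃ₜ M) :
    ∃ ε > 0, ∀ (γ : C(ℝ, M)) (I : Set ℝ), Convex ℝ I → ∀ a ∈ I,
      (∀ t ∈ I, riemannianEDist 𝓘(ℝ, E) (γ a) (γ t) < ε) →
      ∃ (K : ℝ≥0) (d : ℕ), ∀ n : ℕ, ∀ s ∈ I, ∀ t ∈ I,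
        HasC1Rep E (arcClass (iterCurve (f : C(M, M)) γ n) s t) (K * (n + 1) ^ d) := by
  let : PseudoEMetricSpace M := .ofRiemannianMetric 𝓘(ℝ, E) M
  let D : M → M → ℝ≥0∞ := riemannianEDist 𝓘(ℝ, E)
  have hDs : ∀ x y, D x y = D y x := fun x y ↦ riemannianEDist_comm
  have hDt : ∀ x y z, D x z ≤ D x y + D y z := fun x y z ↦ riemannianEDist_triangle
  let F : C(M, M) := f
  obtain ⟨ε, hε, H⟩ := exists_pos_forall_homotopic E M
  have hε3 : 0 < ε / 3 := ENNReal.div_pos hε.ne' (by norm_num)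
  have hε3ε : ε / 3 ≤ ε := ENNReal.div_le_of_le_mul (le_mul_of_one_le_right' (by norm_num))
  have h3 : ∀ {a b c}, a < ε / 3 → b < ε / 3 → c < ε / 3 → a + b + c < ε := fun ha hb hc ↦ by
    rw [← ENNReal.add_thirds ε]
    exact ENNReal.add_lt_add (ENNReal.add_lt_add ha hb) hc
  have hD3 : ∀ {x y z w}, D x y < ε / 3 → D y z < ε / 3 → D z w < ε / 3 → D x w < ε :=
    fun {x y z w} h1 h2 h3' ↦ ((hDt x z w).trans (add_le_add_left (hDt x y z) _)).trans_lt
      (h3 h1 h2 h3')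
  obtain ⟨η, hη, hfη⟩ := EMetric.uniformContinuous_iff.1
    (CompactSpace.uniformContinuous_of_continuous f.continuous) (ε / 3) hε3
  -- Paths of size `ε'` and their images under `f` have size below `ε / 3`, so three hops remain in
  -- a ball where paths are homotopic. The bound by `1` only keeps `ε'`, and later `Kb`, finite.
  let ε' := min (ε / 3) (min η 1)
  have hε' : 0 < ε' := lt_min hε3 (lt_min hη zero_lt_one)
  have hε'3 : ∀ {x y}, D x y < ε' → D x y < ε / 3 := fun h ↦ h.trans_le (min_le_left _ _)
  have hfD : ∀ {x y}, D x y < ε' → D (f x) (f y) < ε / 3 := fun h ↦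
    hfη (h.trans_le ((min_le_right _ _).trans (min_le_left _ _)))
  refine ⟨ε / 3, hε3, fun γ I hI a ha hγ ↦ ?_⟩
  obtain ⟨T, -, hT⟩ := isCompact_univ.elim_nhds_subcover (fun x : M ↦ Metric.eball x ε')
    fun x _ ↦ Metric.eball_mem_nhds x hε'
  have hT' : ∀ q, ∃ z ∈ T, D z q < ε' := fun q ↦ by
    obtain ⟨z, hz, hzq⟩ := mem_iUnion₂.1 (hT (mem_univ q))
    exact ⟨z, hz, Metric.mem_eball'.1 hzq⟩
  choose l hlT hl using hT'
  choose s hs hsl using fun q ↦ exists_path_of_riemannianEDist_lt (hl q)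
  let b : ∀ z, Homotopic.Quotient x₀ z := fun z ↦ .mk (PathConnectedSpace.somePath x₀ z)
  choose Lb hLb hLbr using fun z ↦ exists_hasC1Rep (E := E) (b z)
  have hKb : ∑ z ∈ T, Lb z + ε' ≠ ⊤ := ENNReal.add_ne_top.2
    ⟨ENNReal.sum_ne_top.2 fun z _ ↦ hLb z,
      ne_top_of_le_ne_top ENNReal.one_ne_top ((min_le_right _ _).trans (min_le_right _ _))⟩
  set Kb := ∑ z ∈ T, Lb z + ε'
  -- Reference path to `q`: a fixed path to a point of the finite net, then a short leg. Its length
  -- is bounded by `Kb` uniformly in `q`.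
  let β : ∀ q, Homotopic.Quotient x₀ q := fun q ↦ (b (l q)).trans (.mk (s q))
  have hβ : ∀ q, HasC1Rep E (β q) Kb := fun q ↦
    ((hLbr (l q)).mono (Finset.single_le_sum (f := Lb) (fun _ _ ↦ bot_le) (hlT q))).trans (hs q)
  let δ : Homotopic.Quotient x₀ (f x₀) := .mk (PathConnectedSpace.somePath x₀ (f x₀))
  let α : ∀ t, Homotopic.Quotient x₀ (γ t) := fun t ↦ (β (γ a)).trans (arcClass γ a t)
  have hα : ∀ s t, (α s).trans (arcClass γ s t) = α t := fun s t ↦ by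
    simp only [α, Homotopic.Quotient.trans_assoc, arcClass_trans]
  have htrans : ∀ {x u v w : M} (p : Path u v) (q : Path v w), (∀ t, D x (p t) < ε) →
      (∀ t, D x (q t) < ε) → ∀ t, D x (p.trans q t) < ε := by
    intro x u v w p q hp hq t
    have : p.trans q t ∈ range p ∪ range q := by
      rw [← Path.trans_range]
      exact mem_range_self t
    rcases this with ⟨r, hr⟩ | ⟨r, hr⟩ <;> rw [← hr]
    exacts [hp r, hq r]
  -- The loop depends only on the net point of `γ t`: the short leg followed by the arc back to `γ
  -- a` stays in a small ball about that net point.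
  have hA : ((fun t ↦ (β (γ t)).trans (α t).symm) '' I).Finite := by
    have key : ∀ (z₁ z₂ : M) (t₁ t₂ : ℝ) (p₁ : Path z₁ (γ t₁)) (p₂ : Path z₂ (γ t₂)), z₁ = z₂ →
        (∀ r, D z₁ (p₁ r) < ε') → (∀ r, D z₂ (p₂ r) < ε') → t₁ ∈ I → t₂ ∈ I →
        ((b z₁).trans (.mk p₁)).trans (α t₁).symm = ((b z₂).trans (.mk p₂)).trans (α t₂).symm := by
      rintro z z₂ t₁ t₂ p₁ p₂ rfl h₁ h₂ ht₁ ht₂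
      have hclose : ∀ (t : ℝ) (p : Path z (γ t)), (∀ r, D z (p r) < ε') → t ∈ I → ∀ r,
          D z (p.trans ((Path.segment a t).map γ.continuous).symm r) < ε := by
        intro t p hp ht
        have hz : D z (γ t) < ε / 3 := by simpa using hε'3 (hp 1)
        refine htrans _ _ (fun r ↦ (hε'3 (hp r)).trans_le hε3ε) fun r ↦ ?_
        refine hD3 hz (by rw [hDs]; exact hγ t ht) (hγ _ ?_)
        refine hI.segment_subset ha ht ?_
        rw [segment_eq_image_lineMap]
        exact ⟨unitInterval.symm r, (unitInterval.symm r).2, rfl⟩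
      have h := Homotopic.Quotient.eq.2 (H z _ _ _ _ (hclose t₁ p₁ h₁ ht₁) (hclose t₂ p₂ h₂ ht₂))
      rw [Homotopic.Quotient.mk_trans, Homotopic.Quotient.mk_trans, Homotopic.Quotient.mk_symm,
        Homotopic.Quotient.mk_symm] at h
      have h' : (Homotopic.Quotient.mk p₁).trans (arcClass γ a t₁).symm =
        (Homotopic.Quotient.mk p₂).trans (arcClass γ a t₂).symm := h
      simp only [α, Homotopic.Quotient.symm_trans_trans, Homotopic.Quotient.trans_assoc]
      rw [← Homotopic.Quotient.trans_assoc (.mk p₁), h', Homotopic.Quotient.trans_assoc]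
    exact T.finite_toSet.image_of_forall_eq (l := fun t ↦ l (γ t)) (fun t _ ↦ hlT _)
      fun i hi j hj hij ↦ key _ _ i j _ _ hij (hsl _) (hsl _) hi hj
  -- Likewise the error loop depends only on the net points of `x` and of `f x`, because the two
  -- short legs near `f x` lie in one small ball.
  have hN : (range fun x ↦ (β (f x)).trans (((β x).map F).symm.trans δ.symm)).Finite := by
    have key : ∀ (z₁ z₂ z₁' z₂' q₁ q₂ : M) (p₁ : Path z₁ q₁) (p₂ : Path z₂ q₂)
        (p₁' : Path z₁' (f q₁)) (p₂' : Path z₂' (f q₂)), z₁ = z₂ → z₁' = z₂' →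
        (∀ r, D z₁ (p₁ r) < ε') → (∀ r, D z₂ (p₂ r) < ε') → (∀ r, D z₁' (p₁' r) < ε') →
        (∀ r, D z₂' (p₂' r) < ε') →
        ((b z₁').trans (.mk p₁')).trans ((((b z₁).trans (.mk p₁)).map F).symm.trans δ.symm) =
        ((b z₂').trans (.mk p₂')).trans ((((b z₂).trans (.mk p₂)).map F).symm.trans δ.symm) := by
      rintro z z₂ z' z₂' q₁ q₂ p₁ p₂ p₁' p₂' rfl rfl h₁ h₂ h₁' h₂'
      have hclose : ∀ (q : M) (p : Path z q) (p' : Path z' (f q)), (∀ r, D z (p r) < ε') →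
          (∀ r, D z' (p' r) < ε') → ∀ r, D z' (p'.trans (p.map F.continuous).symm r) < ε := by
        intro q p p' hp hp'
        have hz : D z' (f q) < ε / 3 := by simpa using hε'3 (hp' 1)
        have hq : D (f q) (f z) < ε / 3 := by rw [hDs]; simpa using hfD (hp 1)
        exact htrans _ _ (fun r ↦ (hε'3 (hp' r)).trans_le hε3ε) fun r ↦
          hD3 hz hq (hfD (hp _))
      have h := Homotopic.Quotient.eq.2 (H z' _ _ _ _ (hclose q₁ p₁ p₁' h₁ h₁')
        (hclose q₂ p₂ p₂' h₂ h₂'))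
      rw [Homotopic.Quotient.mk_trans, Homotopic.Quotient.mk_trans, Homotopic.Quotient.mk_symm,
        Homotopic.Quotient.mk_symm] at h
      have h' : (Homotopic.Quotient.mk p₁').trans ((Homotopic.Quotient.mk p₁).map F).symm =
        (Homotopic.Quotient.mk p₂').trans ((Homotopic.Quotient.mk p₂).map F).symm := h
      simp only [Homotopic.Quotient.symm_trans_trans, Homotopic.Quotient.trans_assoc,
        Homotopic.Quotient.map_trans]
      rw [← Homotopic.Quotient.trans_assoc (.mk p₁'), h', Homotopic.Quotient.trans_assoc]
    rw [← image_univ]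
    exact (T.finite_toSet.prod T.finite_toSet).image_of_forall_eq
      (l := fun x ↦ (l x, l (f x))) (fun x _ ↦ ⟨hlT _, hlT _⟩) fun i _ j _ hij ↦
        key _ _ _ _ i j _ _ _ _ (congrArg Prod.fst hij) (congrArg Prod.snd hij)
          (hsl _) (hsl _) (hsl _) (hsl _)
  obtain ⟨S, hS, hGS⟩ := hG
  obtain ⟨φ, N, hNpos, A₀, hA₀, hmem⟩ := exists_stretchSeq (S := S) f γ δ α β I hA hN
  obtain ⟨C, d, hCd⟩ := hGS φ N hNpos A₀ hA₀
  obtain ⟨Λ, hΛ⟩ := exists_hasC1Rep_wordLength (E := E) hS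
  refine ⟨Kb.toNNReal + C * Λ + Kb.toNNReal, d, fun n s hs t ht ↦ ?_⟩
  let c := iterCurve F γ n
  let a : ∀ t, Homotopic.Quotient x₀ (c t) := iterClass F γ δ α n
  let g : ℝ → Homotopic.Quotient x₀ x₀ := fun t ↦ (β (c t)).trans (a t).symm
  have hac : (a s).trans (arcClass c s t) = a t := iterClass_trans_arcClass (f := F) δ hα n s t
  have hgst : HasC1Rep E ((g s).trans (g t).symm)
      (wordDist S (FundamentalGroup.fromPath (g t)) (FundamentalGroup.fromPath (g s)) * Λ) :=
    hΛ _
  have hw := hCd n _ (hmem n t ht) _ (hmem n s hs)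
  -- The arc is a loop conjugated by two reference paths: these cost `Kb` each, and the loop costs
  -- its word length times `Λ`.
  have heq : arcClass c s t = (β (c s)).symm.trans (((g s).trans (g t).symm).trans (β (c t))) := by
    simp only [g, Homotopic.Quotient.symm_trans_trans, Homotopic.Quotient.trans_assoc,
      Homotopic.Quotient.symm_trans_cancel_left, Homotopic.Quotient.symm_symm,
      Homotopic.Quotient.symm_trans, Homotopic.Quotient.trans_refl]
    rw [← hac, Homotopic.Quotient.symm_trans_cancel_left]
  change HasC1Rep E (arcClass c s t) _
  rw [heq]
  refine ((hβ (c s)).symm.trans (hgst.trans (hβ (c t)))).mono ?_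
  have h1 : (1 : ℝ≥0∞) ≤ ((n : ℝ≥0∞) + 1) ^ d := one_le_pow₀ le_add_self
  have h2 : (wordDist S (FundamentalGroup.fromPath (g t)) (FundamentalGroup.fromPath (g s)) : ℝ≥0∞)
      ≤ C * ((n : ℝ≥0∞) + 1) ^ d := by exact_mod_cast hw
  push_cast
  rw [ENNReal.coe_toNNReal hKb, add_mul, add_mul, ← add_assoc]
  refine add_le_add (add_le_add (le_mul_of_one_le_right' h1) ?_) (le_mul_of_one_le_right' h1)
  calc _ ≤ C * ((n : ℝ≥0∞) + 1) ^ d * Λ := by gcongr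
    _ = _ := by ring

end

/-! ### Polynomial growth of iterated leaf arcs. -/

theorem IsCoveringMap.surjective_of_pathConnectedSpace {X Y : Type*} [TopologicalSpace X]
    [TopologicalSpace Y] [Nonempty X] [PathConnectedSpace Y] {P : X → Y} (hP : IsCoveringMap P) :
    Function.Surjective P := by
  intro y
  obtain ⟨e⟩ := ‹Nonempty X›
  let p := PathConnectedSpace.somePath (P e) y
  have h0 : p.toContinuousMap 0 = P e := p.source
  refine ⟨hP.liftPath p e h0 1, ?_⟩
  exact (congrFun (hP.liftPath_lifts p e h0) 1).trans p.target

namespace LineFoliation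

variable {k : ℕ} {M : Type*} [TopologicalSpace M]
  [ChartedSpace (EuclideanSpace ℝ (Fin (k + 1))) M]
  {W : LineFoliation k M}

theorem IsInvariant.isRegularLeafCurve_comp [SecondCountableTopology M]
    {f : M ≃ₘ^1⟮𝓡 (k + 1), 𝓡 (k + 1)⟯ M} (hf : W.IsInvariant f) {γ : ℝ → M} {a b : ℝ}
    (h : IsRegularLeafCurve W.atlas γ (Ioo a b)) :
    IsRegularLeafCurve W.atlas (f ∘ γ) (Ioo a b) := by
  refine ⟨hf.isLeafwise_comp f.continuous ordConnected_Ioo h.1,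
    f.contMDiff.comp_contMDiffOn h.2.1, fun t ht h0 ↦ h.2.2 t ht ?_⟩
  have hfd := f.contMDiff.mdifferentiable one_ne_zero (γ t)
  have h1 := mfderiv_comp t hfd ((h.contMDiffAt isOpen_Ioo ht).mdifferentiableAt one_ne_zero)
  rw [h1] at h0
  refine (f.mfderivToContinuousLinearEquiv one_ne_zero (γ t)).injective ?_
  rw [map_zero]
  exact h0

theorem IsInvariant.isRegularLeafCurve_iterate [SecondCountableTopology M]
    {f : M ≃ₘ^1⟮𝓡 (k + 1), 𝓡 (k + 1)⟯ M} (hf : W.IsInvariant f) {γ : ℝ → M} {a b : ℝ}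
    (h : IsRegularLeafCurve W.atlas γ (Ioo a b)) (n : ℕ) :
    IsRegularLeafCurve W.atlas (f^[n] ∘ γ) (Ioo a b) := by
  induction n with
  | zero => exact h
  | succ n ih =>
    rw [Function.iterate_succ', Function.comp_assoc]
    exact hf.isRegularLeafCurve_comp ih

theorem IsInvariant.isLeafwise_iterate [SecondCountableTopology M]
    {f : M → M} (hf : W.IsInvariant f) (hfc : Continuous f) {γ : ℝ → M} {s : Set ℝ}
    (hs : s.OrdConnected) (h : IsLeafwise W.atlas γ s) (n : ℕ) :
    IsLeafwise W.atlas (f^[n] ∘ γ) s := by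
  induction n with
  | zero => exact h
  | succ n ih =>
    rw [Function.iterate_succ', Function.comp_assoc]
    exact hf.isLeafwise_comp hfc hs ih

variable [RiemannianBundle (fun x : M ↦ TangentSpace (𝓡 (k + 1)) x)]

variable (W) in
/-- A leafwise arc which is homotopic to a path of length `L` can be replaced by a leafwise `C¹`
path of length at most `Q * L + Q` if the foliation is quasi-isometric. -/
theorem exists_leafwise_path [PathConnectedSpace M] {Mt : Type*} [TopologicalSpace Mt] [Nonempty Mt]
    {P : Mt → M} (hP : IsCoveringMap P) {Q : ℝ≥0}
    (hQ : ∀ x : Mt, ∀ y ∈ W.coverLeaf P x, W.coverLeafDist P x y < Q * coverDist k P x y + Q)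
    {c : C(ℝ, M)} {I : Set ℝ} (hI : Convex ℝ I) (hc : IsLeafwise W.atlas c I) {s t : ℝ}
    (hs : s ∈ I) (ht : t ∈ I) {L : ℝ≥0∞}
    (hL : HasC1Rep (EuclideanSpace ℝ (Fin (k + 1))) (arcClass c s t) L) :
    ∃ η : ℝ → M, IsLeafwise W.atlas η (Icc 0 1) ∧
      ContMDiffOn 𝓘(ℝ, ℝ) (𝓡 (k + 1)) 1 η (Icc 0 1) ∧ η 0 = c s ∧ η 1 = c t ∧
      pathELength (𝓡 (k + 1)) η 0 1 ≤ Q * L + Q := by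
  obtain ⟨e, he⟩ := hP.surjective_of_pathConnectedSpace (c s)
  let p : Path (c s) (c t) := (Path.segment s t).map c.continuous
  obtain ⟨q, hq, hqs, hql⟩ := hL
  have hqp : q.Homotopic p := Path.Homotopic.Quotient.eq.1 hq
  have hp0 : p.toContinuousMap 0 = P e := p.source.trans he.symm
  have hq0 : q.toContinuousMap 0 = P e := q.source.trans he.symm
  let Γ := hP.liftPath p e hp0
  let Γ' := hP.liftPath q e hq0
  -- The leafwise arc and the short path are homotopic, so their lifts end at the same point: the
  -- first puts it in the leaf of `e`, the second bounds its distance from `e`.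
  have hend : Γ' 1 = Γ 1 := hP.liftPath_apply_one_eq_of_homotopicRel hqp e hq0 hp0
  let J : ℝ → unitInterval := projIcc 0 1 zero_le_one
  have hJ : Continuous J := continuous_projIcc
  have hJ0 : J 0 = 0 := projIcc_left _
  have hJ1 : J 1 = 1 := projIcc_right _
  have hΓ : P ∘ (Γ ∘ J) = p.extend := funext fun r ↦ congrFun (hP.liftPath_lifts p e hp0) (J r)
  have hΓ' : P ∘ (Γ' ∘ J) = q.extend := funext fun r ↦ congrFun (hP.liftPath_lifts q e hq0) (J r)
  have hmem : Γ 1 ∈ W.coverLeaf P e := by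
    refine ⟨Γ ∘ J, (Γ.continuous.comp hJ).continuousOn, ?_, ?_, ?_⟩
    · rw [hΓ]
      have hsub : MapsTo (AffineMap.lineMap s t : ℝ → ℝ) (Icc 0 1) I := fun r hr ↦
        hI.segment_subset hs ht (by rw [segment_eq_image_lineMap]; exact ⟨r, hr, rfl⟩)
      refine (hc.comp AffineMap.lineMap_continuous.continuousOn hsub).congr fun r hr ↦ ?_
      rw [Path.extend_apply _ hr]
      rfl
    · rw [Function.comp_apply, hJ0]
      exact hP.liftPath_zero p e hp0
    · rw [Function.comp_apply, hJ1]
  have hdist : coverDist k P e (Γ 1) ≤ L := by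
    have hpath : IsLiftedC1Path k P e (Γ 1) (Γ' ∘ J) := by
      refine ⟨(Γ'.continuous.comp hJ).continuousOn, ?_, ?_, ?_⟩
      · rw [Function.comp_apply, hJ0]
        exact hP.liftPath_zero q e hq0
      · rw [Function.comp_apply, hJ1, hend]
      · rw [hΓ']
        exact hqs.contMDiffOn
    refine (iInf₂_le (Γ' ∘ J) hpath).trans ?_
    rw [hΓ']
    exact hql
  -- Strictness allows the infimum to be replaced by an actual path.
  have hlt : W.coverLeafDist P e (Γ 1) < Q * L + Q :=
    (hQ e _ hmem).trans_le (by gcongr)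
  obtain ⟨η, hη⟩ := iInf_lt_iff.1 hlt
  obtain ⟨⟨⟨-, h0, h1, hs⟩, hl⟩, hlen⟩ := iInf_lt_iff.1 hη
  refine ⟨P ∘ η, hl, hs, ?_, ?_, hlen.le⟩
  · rw [Function.comp_apply, h0, he]
  · rw [Function.comp_apply, h1]
    exact (congrFun (hP.liftPath_lifts p e hp0) 1).trans p.target

variable [T2Space M] [CompactSpace M] [ConnectedSpace M] [IsManifold (𝓡 (k + 1)) 1 M]
  [IsContinuousRiemannianBundle (EuclideanSpace ℝ (Fin (k + 1)))
    (fun x : M ↦ TangentSpace (𝓡 (k + 1)) x)]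

/-- The lengths of the iterates of a short arc of a leaf grow at most polynomially. -/
theorem IsInvariant.exists_pathELength_iterate_le [SecondCountableTopology M]
    {Mt : Type*} [TopologicalSpace Mt] [Nonempty Mt] {P : Mt → M} (hP : IsCoveringMap P)
    {x₀ : M} (hG : IsUnstretchable (FundamentalGroup M x₀))
    {f : M ≃ₘ^1⟮𝓡 (k + 1), 𝓡 (k + 1)⟯ M} (hf : W.IsInvariant f) (hqi : W.IsQuasiIsometric P)
    {γ : ℝ → M} {a b t₀ : ℝ} (h : IsRegularLeafCurve W.atlas γ (Ioo a b)) (ht₀ : t₀ ∈ Ioo a b) :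
    ∃ p q, t₀ ∈ Ioo p q ∧ Icc p q ⊆ Ioo a b ∧ ∃ (K : ℝ≥0) (d : ℕ), ∀ n : ℕ,
      pathELength (𝓡 (k + 1)) (f^[n] ∘ γ) p q ≤ K * (n + 1) ^ d := by
  have : LocallyPathConnectedSpace M :=
    ChartedSpace.locallyPathConnectedSpace (EuclideanSpace ℝ (Fin (k + 1))) M
  have : PathConnectedSpace M := pathConnectedSpace_iff_connectedSpace.2 inferInstance
  obtain ⟨Q, -, hQ⟩ := hqi
  obtain ⟨ε, hε, H⟩ := exists_polynomial_hasC1Rep (E := EuclideanSpace ℝ (Fin (k + 1))) hG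
    f.toHomeomorph
  obtain ⟨U, hU, hinj⟩ :=
    exists_injOn_of_mfderiv_ne_zero (h.contMDiffAt isOpen_Ioo ht₀) (h.2.2 t₀ ht₀)
  have hev : ∀ᶠ t in 𝓝 t₀, t ∈ Ioo a b ∧ t ∈ U ∧ riemannianEDist (𝓡 (k + 1)) (γ t₀) (γ t) < ε := by
    filter_upwards [isOpen_Ioo.mem_nhds ht₀, hU,
      (h.contMDiffAt isOpen_Ioo ht₀).continuousAt.eventually
        (eventually_riemannianEDist_lt (𝓡 (k + 1)) (γ t₀) hε)] with t h1 h2 h3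
    exact ⟨h1, h2, h3⟩
  obtain ⟨a', b', hab', hsub⟩ := mem_nhds_iff_exists_Ioo_subset.1 hev
  obtain ⟨p, hp, hpt⟩ := exists_between hab'.1
  obtain ⟨q, htq, hq⟩ := exists_between hab'.2
  have hpq : p ≤ q := (hpt.trans htq).le
  have hIcc : Icc p q ⊆ Ioo a' b' := fun t ht ↦ ⟨hp.trans_le ht.1, ht.2.trans_lt hq⟩
  have hIab : Icc p q ⊆ Ioo a b := fun t ht ↦ (hsub (hIcc ht)).1
  refine ⟨p, q, ⟨hpt, htq⟩, hIab, ?_⟩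
  have hγc : ContinuousOn γ (Icc p q) := h.1.1.mono hIab
  -- `γ` is frozen outside `[p, q]` to obtain a curve defined on all of `ℝ`, as `arcClass` requires.
  let c : C(ℝ, M) := ⟨IccExtend hpq ((Icc p q).domRestrict γ), hγc.domRestrict.Icc_extend'⟩
  have hc : EqOn c γ (Icc p q) := fun t ht ↦
    IccExtend_of_mem hpq ((Icc p q).domRestrict γ) ht
  have htI : t₀ ∈ Icc p q := ⟨hpt.le, htq.le⟩
  obtain ⟨K, d, hK⟩ := H c (Icc p q) (convex_Icc p q) t₀ htI fun t ht ↦ by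
    rw [hc htI, hc ht]
    exact (hsub (hIcc ht)).2.2
  -- The `2` comes from `pathELength_le_two_mul`; the additive `Q` is absorbed using `(n + 1)^d ≥
  -- 1`.
  refine ⟨2 * (Q * K + Q), d, fun n ↦ ?_⟩
  let cn := iterCurve (f.toHomeomorph : C(M, M)) c n
  have hcn : EqOn cn (f^[n] ∘ γ) (Icc p q) := fun t ht ↦ by
    rw [iterCurve_apply, hc ht]
    rfl
  have hreg := (hf.isRegularLeafCurve_iterate h n).mono fun t ht ↦ (hsub ht).1
  have hlw : IsLeafwise W.atlas cn (Icc p q) :=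
    ((hf.isLeafwise_iterate f.continuous ordConnected_Ioo h.1 n).mono hIab).congr hcn
  have hpI : p ∈ Icc p q := left_mem_Icc.2 hpq
  refine (W.pathELength_le_two_mul (B := Q * (K * (n + 1) ^ d) + Q) hreg
    ((f.injective.iterate n).comp_injOn (hinj.mono fun t ht ↦ (hsub ht).2.1)) hp hpq hq
    fun m hm ↦ ?_).trans ?_
  · obtain ⟨η, h1, h2, h3, h4, h5⟩ := W.exists_leafwise_path hP hQ (convex_Icc p q) hlw hpI hm
      (hK n p hpI m hm)
    exact ⟨η, h1, h2, h3.trans (hcn hpI), h4.trans (hcn hm), h5⟩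
  · have h1 : (1 : ℝ≥0∞) ≤ ((n : ℝ≥0∞) + 1) ^ d := one_le_pow₀ le_add_self
    push_cast
    rw [mul_assoc 2, add_mul, mul_assoc (Q : ℝ≥0∞)]
    gcongr
    exact le_mul_of_one_le_right' h1

end LineFoliation

/-! ### From length growth to Lyapunov exponents. -/

theorem nonpos_of_tendsto_log_of_le_pow {g : ℕ → ℝ} {l K : ℝ} {d : ℕ} (hg0 : ∀ n, 0 ≤ g n)
    (hg : ∀ n, g n ≤ K * (n + 1) ^ d)
    (hl : Tendsto (fun n : ℕ ↦ (1 / (n : ℝ)) * Real.log (g n)) atTop (𝓝 l)) : l ≤ 0 := by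
  by_contra! h
  have hr : 1 < Real.exp (l / 2) := Real.one_lt_exp_iff.2 (half_pos h)
  set r := Real.exp (l / 2)
  have h1 : Tendsto (fun n : ℕ ↦ K * r * (((n + 1 : ℕ) : ℝ) ^ d / r ^ (n + 1))) atTop (𝓝 0) := by
    simpa using ((tendsto_pow_const_div_const_pow_of_one_lt d hr).comp
      (tendsto_add_atTop_nat 1)).const_mul (K * r)
  obtain ⟨n, h2, h3, h4⟩ := ((hl.eventually_const_lt (half_lt_self h)).and
    ((h1.eventually_lt_const one_pos).and (eventually_gt_atTop 0))).exists
  have hn : (0 : ℝ) < n := by exact_mod_cast h4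
  have h5 : l / 2 * n < Real.log (g n) := by
    rwa [one_div_mul_eq_div, lt_div_iff₀ hn] at h2
  -- With `Real.log 0 = 0` a vanishing `g n` would not have the large logarithm of `h5`.
  have h6 : 0 < g n := by
    refine (hg0 n).lt_of_ne fun h0 ↦ ?_
    rw [← h0, Real.log_zero] at h5
    exact h5.not_ge (mul_pos (half_pos h) hn).le
  have h7 : r ^ n < g n := by
    rw [← Real.exp_nat_mul, mul_comm]
    exact (Real.lt_log_iff_exp_lt h6).1 h5
  have hrn : 0 < r ^ (n + 1) := by positivity
  rw [← mul_div_assoc, div_lt_one hrn, pow_succ', mul_assoc, mul_comm r, mul_comm r, ← mul_assoc,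
    mul_lt_mul_iff_left₀ (one_pos.trans hr)] at h3
  refine (h7.trans_le (hg n)).not_ge ?_
  exact_mod_cast h3.le

/-- With weights `(n + 1)^{-(d+2)}` the sum of the functions has integral at most `K ∑ (n +
1)^{-2}`, so it is finite almost everywhere and bounds each of its terms. -/
theorem ae_exists_forall_le_mul_pow {α : Type*} [MeasurableSpace α] {μ : Measure α}
    {F : ℕ → α → ℝ≥0∞} (hF : ∀ n, AEMeasurable (F n) μ) {K : ℝ≥0} {d : ℕ}
    (h : ∀ n : ℕ, ∫⁻ t, F n t ∂μ ≤ K * (n + 1) ^ d) :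
    ∀ᵐ t ∂μ, ∃ C : ℝ≥0, ∀ n : ℕ, F n t ≤ C * (n + 1) ^ (d + 2) := by
  have hfin : ∫⁻ t, ∑' n : ℕ, ((n : ℝ≥0∞) + 1)⁻¹ ^ (d + 2) * F n t ∂μ ≠ ⊤ := by
    rw [lintegral_tsum fun n ↦ (hF n).const_mul _]
    have hs : Summable fun n : ℕ ↦ K * (((n + 1 : ℕ) : ℝ≥0) ^ 2)⁻¹ :=
      (NNReal.summable_coe.1 (by
        simpa [Function.comp_def] using (Real.summable_nat_pow_inv.2 one_lt_two).comp_injective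
          (add_left_injective 1))).mul_left K
    refine ne_top_of_le_ne_top (ENNReal.tsum_coe_ne_top_iff_summable.2 hs)
      (ENNReal.tsum_le_tsum fun n ↦ ?_)
    rw [lintegral_const_mul'' _ (hF n)]
    refine (mul_le_mul_right (h n) _).trans (le_of_eq ?_)
    have : (((n : ℝ≥0∞) + 1)⁻¹) ^ d * ((n : ℝ≥0∞) + 1) ^ d = 1 := by
      rw [← mul_pow, ENNReal.inv_mul_cancel (by simp) (by finiteness), one_pow]
    rw [ENNReal.coe_mul, ENNReal.coe_inv (by positivity)]
    push_cast
    rw [pow_add, ENNReal.inv_pow, mul_comm (_ ^ d), mul_assoc, mul_left_comm (_ ^ d), this, mul_one,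
      mul_comm]
  filter_upwards [ae_lt_top' (AEMeasurable.tsum fun n ↦ (hF n).const_mul _) hfin]
    with t ht
  refine ⟨(∑' n : ℕ, ((n : ℝ≥0∞) + 1)⁻¹ ^ (d + 2) * F n t).toNNReal, fun n ↦ ?_⟩
  rw [ENNReal.coe_toNNReal ht.ne]
  have h1 := ENNReal.le_tsum (f := fun n : ℕ ↦ ((n : ℝ≥0∞) + 1)⁻¹ ^ (d + 2) * F n t) n
  calc F n t = (((n : ℝ≥0∞) + 1)⁻¹ ^ (d + 2) * F n t) * ((n : ℝ≥0∞) + 1) ^ (d + 2) := by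
        rw [mul_right_comm, ← mul_pow, ENNReal.inv_mul_cancel (by simp) (by finiteness), one_pow,
          one_mul]
    _ ≤ _ := by gcongr

theorem ContinuousLinearMap.norm_comp_subtypeL_span_singleton {E F : Type*}
    [NormedAddCommGroup E] [NormedSpace ℝ E] [NormedAddCommGroup F] [NormedSpace ℝ F]
    (T : E →L[ℝ] F) (v : E) {S : Submodule ℝ E} (hS : S = Submodule.span ℝ {v}) :
    ‖T.comp S.subtypeL‖ = ‖T v‖ / ‖v‖ := by
  subst hS
  rcases eq_or_ne v 0 with rfl | hv
  · rw [norm_zero, div_zero]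
    refine le_antisymm (ContinuousLinearMap.opNorm_le_bound _ le_rfl ?_)
      (ContinuousLinearMap.opNorm_nonneg _)
    rintro ⟨x, hx⟩
    obtain ⟨c, rfl⟩ := Submodule.mem_span_singleton.1 hx
    simp
  have hv' : 0 < ‖v‖ := norm_pos_iff.2 hv
  refine le_antisymm (ContinuousLinearMap.opNorm_le_bound _ (by positivity) ?_) ?_
  · rintro ⟨x, hx⟩
    obtain ⟨c, rfl⟩ := Submodule.mem_span_singleton.1 hx
    simp only [ContinuousLinearMap.comp_apply, Submodule.subtypeL_apply, map_smul, norm_smul,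
      Submodule.coe_norm]
    field_simp
    rfl
  · rw [div_le_iff₀ hv']
    exact (T.comp (Submodule.span ℝ {v}).subtypeL).le_opNorm
      ⟨v, Submodule.mem_span_singleton_self v⟩

namespace LineFoliation

variable {k : ℕ} {M : Type*} [TopologicalSpace M] [T2Space M]
  [ChartedSpace (EuclideanSpace ℝ (Fin (k + 1))) M] [IsManifold (𝓡 (k + 1)) 1 M]
  [RiemannianBundle (fun x : M ↦ TangentSpace (𝓡 (k + 1)) x)]
  {W : LineFoliation k M}

theorem norm_mfderiv_comp_tangentLine {γ : ℝ → M} {s : Set ℝ}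
    (hγ : IsRegularLeafCurve W.atlas γ s) (hs : IsOpen s) {t : ℝ} (ht : t ∈ s) {g : M → M}
    (hg : MDifferentiableAt (𝓡 (k + 1)) (𝓡 (k + 1)) g (γ t)) :
    ‖(mfderiv (𝓡 (k + 1)) (𝓡 (k + 1)) g (γ t)).comp (W.tangentLine (γ t)).subtypeL‖ =
      speed (EuclideanSpace ℝ (Fin (k + 1))) (g ∘ γ) t /
        speed (EuclideanSpace ℝ (Fin (k + 1))) γ t := by
  rw [ContinuousLinearMap.norm_comp_subtypeL_span_singleton _ _ (W.tangentLine_eq_span hγ hs ht)]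
  congr 1
  refine norm_tangentSpace_congr rfl ?_
  have h1 := mfderiv_comp t hg ((hγ.contMDiffAt hs ht).mdifferentiableAt one_ne_zero)
  exact (congrArg (fun T : ℝ →L[ℝ] EuclideanSpace ℝ (Fin (k + 1)) ↦ T 1) h1).symm

variable [CompactSpace M] [ConnectedSpace M]
  [IsContinuousRiemannianBundle (EuclideanSpace ℝ (Fin (k + 1)))
    (fun x : M ↦ TangentSpace (𝓡 (k + 1)) x)]

/-- Almost no point of a leaf has a positive forward Lyapunov exponent along the leaf. -/
theorem IsInvariant.volume_positive_exponent_eq_zero [SecondCountableTopology M]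
    {Mt : Type*} [TopologicalSpace Mt] [Nonempty Mt] {P : Mt → M} (hP : IsCoveringMap P)
    {x₀ : M} (hG : IsUnstretchable (FundamentalGroup M x₀))
    {f : M ≃ₘ^1⟮𝓡 (k + 1), 𝓡 (k + 1)⟯ M} (hf : W.IsInvariant f) (hqi : W.IsQuasiIsometric P)
    {γ : ℝ → M} {a b : ℝ} (h : IsRegularLeafCurve W.atlas γ (Ioo a b)) :
    volume {t ∈ Ioo a b | ∃ l > 0, Tendsto (fun n : ℕ ↦ (1 / (n : ℝ)) *
      Real.log ‖(mfderiv (𝓡 (k + 1)) (𝓡 (k + 1)) (f^[n]) (γ t)).comp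
        (W.tangentLine (γ t)).subtypeL‖) atTop (𝓝 l)} = 0 := by
  have hfn : ∀ n : ℕ, ContMDiff (𝓡 (k + 1)) (𝓡 (k + 1)) 1 f^[n] := fun n ↦ by
    induction n with
    | zero => exact contMDiff_id
    | succ n ih => rw [Function.iterate_succ']; exact f.contMDiff.comp ih
  -- The polynomial length bound is available only for a short arc about each parameter.
  refine measure_null_of_locally_null _ fun t₀ ht₀ ↦ ?_
  obtain ⟨p, q, htpq, hsub, K, d, hK⟩ := hf.exists_pathELength_iterate_le hP hG hqi h ht₀.1
  refine ⟨_, inter_mem_nhdsWithin _ (isOpen_Ioo.mem_nhds htpq), ?_⟩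
  have hae := ae_exists_forall_le_mul_pow (μ := volume.restrict (Ioo p q))
    (F := fun n t ↦ ENNReal.ofReal (speed (EuclideanSpace ℝ (Fin (k + 1))) (f^[n] ∘ γ) t))
    (fun n ↦ (((continuousOn_speed isOpen_Ioo (hf.isRegularLeafCurve_iterate h n).2.1).mono
      (Ioo_subset_Icc_self.trans hsub)).aemeasurable measurableSet_Ioo).ennreal_ofReal)
    (K := K) (d := d) (fun n ↦ by
      rw [restrict_Ioo_eq_restrict_Icc, ← pathELength_eq_lintegral_speed]
      exact hK n)
  rw [ae_restrict_iff' measurableSet_Ioo] at hae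
  refine measure_mono_null ?_ (ae_iff.1 hae)
  intro t ht hC
  obtain ⟨⟨htab, l, hl, hlim⟩, htp⟩ := ht
  obtain ⟨C, hC⟩ := hC htp
  refine hl.not_ge (nonpos_of_tendsto_log_of_le_pow
    (K := C / speed (EuclideanSpace ℝ (Fin (k + 1))) γ t) (d := d + 2) (fun n ↦ ContinuousLinearMap.opNorm_nonneg _)
    (fun n ↦ ?_) hlim)
  rw [norm_mfderiv_comp_tangentLine h isOpen_Ioo htab ((hfn n).mdifferentiable one_ne_zero _),
    div_mul_eq_mul_div]
  gcongr
  · exact speed_nonneg _ _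
  have h1 : ((C : ℝ≥0∞) * (n + 1) ^ (d + 2)) = ENNReal.ofReal (C * (n + 1) ^ (d + 2)) := by
    rw [ENNReal.ofReal_mul C.coe_nonneg, ENNReal.ofReal_pow (by positivity),
      ENNReal.ofReal_add (by positivity) zero_le_one, ENNReal.ofReal_natCast, ENNReal.ofReal_one,
      ENNReal.ofReal_coe_nnreal]
  have h2 := hC n
  rw [h1] at h2
  exact (ENNReal.ofReal_le_ofReal_iff (by positivity)).1 h2

/-- The two-sided limit restricts to both ends of `ℤ`: a positive exponent is a positive forward
exponent of `f`, a negative one becomes positive for `f.symm`. -/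
theorem IsInvariant.isLeafwiseNull_nonzeroExponentSet [SecondCountableTopology M]
    {Mt : Type*} [TopologicalSpace Mt] [Nonempty Mt] {P : Mt → M} (hP : IsCoveringMap P)
    {x₀ : M} (hG : IsUnstretchable (FundamentalGroup M x₀))
    {f : M ≃ₘ^1⟮𝓡 (k + 1), 𝓡 (k + 1)⟯ M} (hf : W.IsInvariant f) (hqi : W.IsQuasiIsometric P) :
    W.IsLeafwiseNull (W.nonzeroExponentSet f.toEquiv) := by
  intro x γ a b h _
  have hf' : W.IsInvariant f.symm := hf.symm (f := f.toEquiv)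
  refine measure_mono_null ?_ (measure_union_null
    (hf.volume_positive_exponent_eq_zero hP hG hqi h)
    (hf'.volume_positive_exponent_eq_zero hP hG hqi h))
  rintro t ⟨ht, l, hl, hl0⟩
  rcases hl0.lt_or_gt with h0 | h0
  · refine Or.inr ⟨ht, -l, neg_pos.2 h0, ?_⟩
    have hinj : Function.Injective fun n : ℕ ↦ -(n : ℤ) := neg_injective.comp Nat.cast_injective
    have h1 := (hl.comp hinj.tendsto_cofinite).neg
    rw [Nat.cofinite_eq_atTop] at h1
    refine h1.congr fun n ↦ ?_
    have h2 : (⇑((f.toEquiv : Equiv.Perm M) ^ (-(n : ℤ))) : M → M) = f.symm^[n] := by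
      rw [zpow_neg, zpow_natCast, ← inv_pow]
      rfl
    simp only [Function.comp_apply]
    rw [h2, Int.cast_neg, Int.cast_natCast]
    ring
  · refine Or.inl ⟨ht, l, h0, ?_⟩
    have h1 := hl.comp (Nat.cast_injective (R := ℤ)).tendsto_cofinite
    rw [Nat.cofinite_eq_atTop] at h1
    refine h1.congr fun n ↦ ?_
    have h2 : (⇑((f.toEquiv : Equiv.Perm M) ^ (n : ℤ)) : M → M) = f^[n] := by
      rw [zpow_natCast]
      rfl
    simp only [Function.comp_apply]
    rw [h2, Int.cast_natCast]

end LineFoliation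

/-! ### Borel measurability of the set of nonzero exponents. -/

theorem measurable_of_forall_exists_isOpen {X Y : Type*} [TopologicalSpace X]
    [SecondCountableTopology X] [MeasurableSpace X] [OpensMeasurableSpace X] [MeasurableSpace Y]
    {G : X → Y} (h : ∀ z, ∃ O, IsOpen O ∧ z ∈ O ∧ Measurable (O.domRestrict G)) :
    Measurable G := by
  choose O hO hz hG using h
  obtain ⟨t, ht, htU⟩ := TopologicalSpace.countable_cover_nhds fun z ↦ (hO z).mem_nhds (hz z)
  intro B hB
  have : G ⁻¹' B = ⋃ x ∈ t, Subtype.val '' ((O x).domRestrict G ⁻¹' B) := by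
    ext y
    have hy : y ∈ ⋃ x ∈ t, O x := htU ▸ mem_univ y
    simp only [mem_iUnion, exists_prop] at hy
    obtain ⟨x, hx, hyx⟩ := hy
    simp only [mem_iUnion, mem_image, exists_prop]
    constructor
    · exact fun hyB ↦ ⟨x, hx, ⟨y, hyx⟩, hyB, rfl⟩
    · rintro ⟨x, hx, ⟨y', hy'⟩, hyB, rfl⟩
      exact hyB
  rw [this]
  exact MeasurableSet.biUnion ht fun x _ ↦ (hO x).measurableSet.subtype_image (hG x hB)

section Trivialization

variable {E : Type*} [NormedAddCommGroup E] [NormedSpace ℝ E]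
  {M : Type*} [TopologicalSpace M] [ChartedSpace E M] [IsManifold 𝓘(ℝ, E) 1 M]

theorem symmL_trivializationAt_deriv {z : M} {c : ℝ → M} {t₀ : ℝ} {w : E}
    (hz : c t₀ ∈ (chartAt E z).source) (hc : MDifferentiableAt 𝓘(ℝ, ℝ) 𝓘(ℝ, E) c t₀)
    (hw : HasDerivAt (extChartAt 𝓘(ℝ, E) z ∘ c) w t₀) :
    (trivializationAt E (TangentSpace 𝓘(ℝ, E)) z).symmL ℝ (c t₀) w =
      mfderiv 𝓘(ℝ, ℝ) 𝓘(ℝ, E) c t₀ 1 := by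
  have hb : c t₀ ∈ (trivializationAt E (TangentSpace 𝓘(ℝ, E)) z).baseSet := hz
  rw [← Trivialization.symmL_continuousLinearMapAt (R := ℝ) _ hb (mfderiv 𝓘(ℝ, ℝ) 𝓘(ℝ, E) c t₀ 1)]
  congr 1
  rw [TangentBundle.continuousLinearMapAt_trivializationAt hz]
  have h1 := mfderiv_comp t₀ (mdifferentiableAt_extChartAt (I := 𝓘(ℝ, E)) hz) hc
  rw [mfderiv_eq_fderiv] at h1
  rw [← hw.deriv, ← fderiv_apply_one_eq_deriv]
  exact congrArg (fun T : ℝ →L[ℝ] E ↦ T 1) h1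

theorem continuousOn_symmL_trivializationAt (z : M) :
    ContinuousOn (fun p : M × E ↦ (⟨p.1, (trivializationAt E (TangentSpace 𝓘(ℝ, E)) z).symmL ℝ
      p.1 p.2⟩ : TangentBundle 𝓘(ℝ, E) M)) ((chartAt E z).source ×ˢ univ) := by
  refine (trivializationAt E (TangentSpace 𝓘(ℝ, E)) z).continuousOn_symm.congr ?_
  rintro ⟨y, v⟩ ⟨hy, -⟩
  have hb : y ∈ (trivializationAt E (TangentSpace 𝓘(ℝ, E)) z).baseSet := hy
  exact congrArg (TotalSpace.mk y) (Trivialization.symmL_apply (R := ℝ) _ hb v)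

variable [RiemannianBundle (fun x : M ↦ TangentSpace 𝓘(ℝ, E) x)]
  [IsContinuousRiemannianBundle E (fun x : M ↦ TangentSpace 𝓘(ℝ, E) x)]

theorem continuousOn_norm_mfderiv_symmL {g : M → M} (hg : ContMDiff 𝓘(ℝ, E) 𝓘(ℝ, E) 1 g) (z : M) :
    ContinuousOn (fun p : M × E ↦ ‖mfderiv 𝓘(ℝ, E) 𝓘(ℝ, E) g p.1
      ((trivializationAt E (TangentSpace 𝓘(ℝ, E)) z).symmL ℝ p.1 p.2)‖)
      ((chartAt E z).source ×ˢ univ) := by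
  have h1 := (hg.continuous_tangentMap le_rfl).comp_continuousOn
    (continuousOn_symmL_trivializationAt (E := E) z)
  exact ContinuousOn.norm_bundle (V := fun x : M ↦ TangentSpace 𝓘(ℝ, E) x) h1

theorem continuousOn_norm_symmL (z : M) :
    ContinuousOn (fun p : M × E ↦
      ‖(trivializationAt E (TangentSpace 𝓘(ℝ, E)) z).symmL ℝ p.1 p.2‖)
      ((chartAt E z).source ×ˢ univ) :=
  ContinuousOn.norm_bundle (V := fun x : M ↦ TangentSpace 𝓘(ℝ, E) x)
    (continuousOn_symmL_trivializationAt (E := E) z)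

end Trivialization

namespace LineFoliation

variable {k : ℕ} {M : Type*} [TopologicalSpace M]

/-- The translation of points along the plaques of a foliation chart. -/
noncomputable def plaqueShift (φ : OpenPartialHomeomorph M (ℝ × EuclideanSpace ℝ (Fin k)))
    (x : M) (τ : ℝ) : M :=
  φ.symm ((φ x).1 + τ, (φ x).2)

/-- Continuity of the shift at `(z, 0)` gives one range of shifts that works for all points near
`z`, so that a secant with fixed `τ` is a function on an open set. -/
theorem exists_plaqueShift_mem (φ : OpenPartialHomeomorph M (ℝ × EuclideanSpace ℝ (Fin k)))
    {z : M} (hz : z ∈ φ.source) {N : Set M} (hN : N ∈ 𝓝 z) :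
    ∃ O, IsOpen O ∧ z ∈ O ∧ O ⊆ N ∧ O ⊆ φ.source ∧ ∃ r > 0, ∀ x ∈ O, ∀ τ ∈ Ioo (-r) r,
      ((φ x).1 + τ, (φ x).2) ∈ φ.target ∧ plaqueShift φ x τ ∈ N := by
  have hφ : ContinuousAt (fun p : M × ℝ ↦ ((φ p.1).1 + p.2, (φ p.1).2)) (z, 0) := by
    have h1 : ContinuousAt (fun p : M × ℝ ↦ φ p.1) (z, 0) :=
      ContinuousAt.comp (f := Prod.fst) (φ.continuousAt hz) continuousAt_fst
    exact (h1.fst.add continuousAt_snd).prodMk h1.snd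
  have h0 : ((φ z).1 + 0, (φ z).2) = φ z := by rw [add_zero]
  have hev1 : ∀ᶠ p in 𝓝 ((z, 0) : M × ℝ), ((φ p.1).1 + p.2, (φ p.1).2) ∈ φ.target := by
    refine hφ.eventually (φ.open_target.mem_nhds ?_)
    change ((φ z).1 + 0, (φ z).2) ∈ φ.target
    rw [h0]
    exact φ.map_source hz
  have hev2 : ∀ᶠ p in 𝓝 ((z, 0) : M × ℝ), plaqueShift φ p.1 p.2 ∈ N := by
    have h2 : ContinuousAt (fun p : M × ℝ ↦ plaqueShift φ p.1 p.2) (z, 0) := by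
      refine ContinuousAt.comp (g := φ.symm) ?_ hφ
      change ContinuousAt φ.symm ((φ z).1 + 0, (φ z).2)
      rw [h0]
      exact φ.continuousAt_symm (φ.map_source hz)
    refine h2.eventually ?_
    change ∀ᶠ y in 𝓝 (φ.symm ((φ z).1 + 0, (φ z).2)), y ∈ N
    rw [h0, φ.left_inv hz]
    exact hN
  obtain ⟨A, hA, B, hB, hAB⟩ := mem_nhds_prod_iff.1 (hev1.and hev2)
  obtain ⟨O, hO, hOo, hzO⟩ := mem_nhds_iff.1 (inter_mem hA (inter_mem hN (φ.open_source.mem_nhds hz)))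
  obtain ⟨r, hr, hrB⟩ := Metric.mem_nhds_iff.1 hB
  rw [Real.ball_eq_Ioo, zero_sub, zero_add] at hrB
  exact ⟨O, hOo, hzO, fun x hx ↦ (hO hx).2.1, fun x hx ↦ (hO hx).2.2, r, hr,
    fun x hx τ hτ ↦ hAB (mk_mem_prod (hO hx).1 (hrB hτ))⟩

variable [ChartedSpace (EuclideanSpace ℝ (Fin (k + 1))) M] {W : LineFoliation k M}

theorem isLeafwise_plaqueShift {φ : OpenPartialHomeomorph M (ℝ × EuclideanSpace ℝ (Fin k))}
    (hφ : φ ∈ W.atlas) {x : M} {s : Set ℝ}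
    (hs : ∀ τ ∈ s, ((φ x).1 + τ, (φ x).2) ∈ φ.target) :
    IsLeafwise W.atlas (plaqueShift φ x) s := by
  have hc : ContinuousOn (plaqueShift φ x) s :=
    φ.continuousOn_symm.comp (by fun_prop) hs
  refine ⟨hc, fun t ht ψ hψ hψt ↦ ?_⟩
  obtain ⟨V, hV, h⟩ := W.compatible φ hφ ψ hψ (plaqueShift φ x t) ⟨φ.map_target (hs t ht), hψt⟩
  filter_upwards [(hc t ht).eventually hV, self_mem_nhdsWithin] with r hr hrs
  refine h _ hr _ (mem_of_mem_nhds hV) ?_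
  rw [plaqueShift, plaqueShift, φ.right_inv (hs r hrs), φ.right_inv (hs t ht)]

variable [T2Space M] [IsManifold (𝓡 (k + 1)) 1 M]

/-- The secants of the plaques, rescaled, converge to a tangent vector of the leaf. -/
theorem exists_tendsto_smul_secant {φ : OpenPartialHomeomorph M (ℝ × EuclideanSpace ℝ (Fin k))}
    (hφ : φ ∈ W.atlas) {z x : M} (hx : x ∈ φ.source)
    (hxz : x ∈ (chartAt (EuclideanSpace ℝ (Fin (k + 1))) z).source) {r : ℝ} (hr : 0 < r)
    (hs : ∀ τ ∈ Ioo (-r) r, ((φ x).1 + τ, (φ x).2) ∈ φ.target) :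
    ∃ (a : ℝ → ℝ) (w : EuclideanSpace ℝ (Fin (k + 1))), (∀ᶠ τ in 𝓝[≠] 0, a τ ≠ 0) ∧
      Tendsto (fun τ ↦ a τ • (extChartAt (𝓡 (k + 1)) z (plaqueShift φ x τ) -
        extChartAt (𝓡 (k + 1)) z x)) (𝓝[≠] 0) (𝓝 w) ∧
      (trivializationAt _ (TangentSpace (𝓡 (k + 1))) z).symmL ℝ x w ≠ 0 ∧
      W.tangentLine x = Submodule.span ℝ
        {(trivializationAt _ (TangentSpace (𝓡 (k + 1))) z).symmL ℝ x w} := by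
  obtain ⟨c, ε, hε, rfl, hc⟩ := W.leaves_C1 x
  have h0 : (0 : ℝ) ∈ Ioo (-ε) ε := ⟨by linarith, hε⟩
  have hT : Ioo (-r) r ∈ 𝓝 (0 : ℝ) := Ioo_mem_nhds (by linarith) hr
  have hη0 : plaqueShift φ (c 0) 0 = c 0 := by
    rw [plaqueShift, add_zero]
    exact φ.left_inv hx
  obtain ⟨σ, hσ, hσ0, hσe⟩ := W.exists_eventuallyEq_comp hc isOpen_Ioo h0
    (isLeafwise_plaqueShift hφ hs) hT hη0
  have hc0 := hc.contMDiffAt isOpen_Ioo h0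
  have he : ContMDiffAt (𝓡 (k + 1)) (𝓡 (k + 1)) 1 (extChartAt (𝓡 (k + 1)) z) (c 0) :=
    contMDiffAt_extChartAt' hxz
  have hd : HasDerivAt (extChartAt (𝓡 (k + 1)) z ∘ c)
      (deriv (extChartAt (𝓡 (k + 1)) z ∘ c) 0) 0 :=
    ((he.comp 0 hc0).contDiffAt.differentiableAt one_ne_zero).hasDerivAt
  have hsymm := symmL_trivializationAt_deriv hxz (hc0.mdifferentiableAt one_ne_zero) hd
  -- The plaque is parametrized only continuously, so secants must be divided by the parameter `σ τ`
  -- of the `C¹` curve rather than by `τ`. It is nonzero because the shift is injective in `τ`.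
  have hne : ∀ᶠ τ in 𝓝[≠] (0 : ℝ), σ τ ≠ 0 := by
    filter_upwards [mem_nhdsWithin_of_mem_nhds hσe, mem_nhdsWithin_of_mem_nhds hT,
      self_mem_nhdsWithin] with τ h1 h2 h3 h4
    have h5 : plaqueShift φ (c 0) τ = c 0 := by rw [h1, Function.comp_apply, h4]
    have h6 := congrArg (fun y ↦ (φ y).1) h5
    simp only [plaqueShift] at h6
    rw [φ.right_inv (hs τ h2)] at h6
    exact h3 (by simpa using h6)
  refine ⟨fun τ ↦ (σ τ)⁻¹, deriv (extChartAt (𝓡 (k + 1)) z ∘ c) 0, hne.mono fun τ h ↦ inv_ne_zero h, ?_, ?_, ?_⟩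
  · have h1 : Tendsto σ (𝓝[≠] 0) (𝓝[≠] 0) := by
      refine tendsto_nhdsWithin_iff.2 ⟨?_, hne⟩
      have := hσ.tendsto
      rw [hσ0] at this
      exact this.mono_left nhdsWithin_le_nhds
    refine (hd.tendsto_slope_zero.comp h1).congr' ?_
    filter_upwards [mem_nhdsWithin_of_mem_nhds hσe] with τ h2
    simp only [Function.comp_apply, zero_add, h2]
  · rw [hsymm]
    exact hc.2.2 0 h0
  · rw [hsymm]
    exact W.tangentLine_eq_span hc isOpen_Ioo h0

variable [RiemannianBundle (fun x : M ↦ TangentSpace (𝓡 (k + 1)) x)]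
  [IsContinuousRiemannianBundle (EuclideanSpace ℝ (Fin (k + 1)))
    (fun x : M ↦ TangentSpace (𝓡 (k + 1)) x)]

variable (W) in
-- The norm is `‖Dg v‖ / ‖v‖` for any `v ≠ 0` in the tangent line. This quotient is invariant under
-- scaling, so secants along plaques can be used without the rescaling factors, whose dependence on
-- the point is uncontrolled. The quotients are then measurable in the point and converge.
theorem measurable_norm_mfderiv_comp_tangentLine [SecondCountableTopology M] [MeasurableSpace M]
    [BorelSpace M] {g : M → M} (hg : ContMDiff (𝓡 (k + 1)) (𝓡 (k + 1)) 1 g) :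
    Measurable fun x ↦
      ‖(mfderiv (𝓡 (k + 1)) (𝓡 (k + 1)) g x).comp (W.tangentLine x).subtypeL‖ := by
  refine measurable_of_forall_exists_isOpen fun z ↦ ?_
  obtain ⟨φ, hφ, hφz⟩ := W.cover z
  let e := extChartAt (𝓡 (k + 1)) z
  let N := (chartAt (EuclideanSpace ℝ (Fin (k + 1))) z).source
  let T := (trivializationAt (EuclideanSpace ℝ (Fin (k + 1))) (TangentSpace (𝓡 (k + 1))) z).symmL ℝ
  have hN : N ∈ 𝓝 z := chart_source_mem_nhds _ z
  obtain ⟨O, hO, hzO, hON, hOφ, r, hr, hshift⟩ := exists_plaqueShift_mem φ hφz hN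
  refine ⟨O, hO, hzO, ?_⟩
  -- The denominator `m + 2` keeps the shift strictly below `r` already for `m = 0`.
  let u : ℕ → M → EuclideanSpace ℝ (Fin (k + 1)) := fun m x ↦
    e (plaqueShift φ x (r / (m + 2))) - e x
  have hτ : ∀ m : ℕ, r / (m + 2) ∈ Ioo (-r) r := fun m ↦ by
    have : 0 < r / (m + 2) := by positivity
    refine ⟨by linarith, div_lt_self hr ?_⟩
    have : (0 : ℝ) ≤ m := m.cast_nonneg
    linarith
  have hec : ContinuousOn e N := by
    have := continuousOn_extChartAt (I := 𝓡 (k + 1)) z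
    rwa [extChartAt_source] at this
  have hu : ∀ m, ContinuousOn (u m) O := fun m ↦ by
    refine (hec.comp ?_ fun x hx ↦ (hshift x hx _ (hτ m)).2).sub (hec.mono hON)
    have hφc := φ.continuousOn.mono hOφ
    exact φ.continuousOn_symm.comp ((hφc.fst.add continuousOn_const).prodMk hφc.snd)
      fun x hx ↦ (hshift x hx _ (hτ m)).1
  have hpair : ∀ m, ContinuousOn (fun x ↦ (x, u m x)) O := fun m ↦ continuousOn_id.prodMk (hu m)
  have hmaps : ∀ m, MapsTo (fun x ↦ (x, u m x)) O (N ×ˢ univ) := fun m x hx ↦ ⟨hON hx, mem_univ _⟩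
  refine measurable_of_tendsto_metrizable
    (f := fun m ↦ O.domRestrict fun x ↦
      ‖mfderiv (𝓡 (k + 1)) (𝓡 (k + 1)) g x (T x (u m x))‖ / ‖T x (u m x)‖) (fun m ↦ ?_) ?_
  · exact ((continuousOn_norm_mfderiv_symmL hg z).comp (hpair m)
      (hmaps m)).domRestrict.measurable.div
      ((continuousOn_norm_symmL z).comp (hpair m) (hmaps m)).domRestrict.measurable
  · rw [tendsto_pi_nhds]
    rintro ⟨x, hx⟩
    obtain ⟨a, w, ha, hw, hw0, hspan⟩ := exists_tendsto_smul_secant hφ (hOφ hx) (hON hx) hr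
      fun τ hτ ↦ (hshift x hx τ hτ).1
    have hlim : Tendsto (fun m : ℕ ↦ r / ((m : ℝ) + 2)) atTop (𝓝[≠] 0) := by
      refine tendsto_nhdsWithin_iff.2 ⟨?_, Eventually.of_forall fun m ↦ ?_⟩
      · exact tendsto_const_nhds.div_atTop
          (tendsto_atTop_add_const_right _ _ tendsto_natCast_atTop_atTop)
      · have : 0 < r / ((m : ℝ) + 2) := by positivity
        exact this.ne'
    have hx1 : Continuous fun v : EuclideanSpace ℝ (Fin (k + 1)) ↦ (x, v) := by fun_prop
    have hx2 : ∀ v : EuclideanSpace ℝ (Fin (k + 1)), (x, v) ∈ N ×ˢ univ := fun v ↦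
      ⟨hON hx, mem_univ v⟩
    have h1 : Tendsto (fun v ↦ ‖mfderiv (𝓡 (k + 1)) (𝓡 (k + 1)) g x (T x v)‖ / ‖T x v‖) (𝓝 w)
        (𝓝 (‖mfderiv (𝓡 (k + 1)) (𝓡 (k + 1)) g x (T x w)‖ / ‖T x w‖)) :=
      (((continuousOn_norm_mfderiv_symmL hg z).comp_continuous hx1 hx2).tendsto w).div
        (((continuousOn_norm_symmL z).comp_continuous hx1 hx2).tendsto w) (norm_ne_zero_iff.2 hw0)
    have h2 := h1.comp (hw.comp hlim)
    simp only [domRestrict_apply]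
    rw [ContinuousLinearMap.norm_comp_subtypeL_span_singleton _ _ hspan]
    refine h2.congr' ?_
    filter_upwards [hlim.eventually ha] with m hm
    simp only [Function.comp_apply]
    rw [map_smul, map_smul, norm_smul, norm_smul, mul_div_mul_left _ _ (norm_ne_zero_iff.2 hm)]

theorem measurableSet_nonzeroExponentSet [SecondCountableTopology M] [MeasurableSpace M]
    [BorelSpace M] (W : LineFoliation k M) (f : M ≃ₘ^1⟮𝓡 (k + 1), 𝓡 (k + 1)⟯ M) :
    MeasurableSet (W.nonzeroExponentSet f.toEquiv) := by
  have hiter : ∀ (g : M ≃ₘ^1⟮𝓡 (k + 1), 𝓡 (k + 1)⟯ M) (n : ℕ),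
      ContMDiff (𝓡 (k + 1)) (𝓡 (k + 1)) 1 g^[n] := fun g n ↦ by
    induction n with
    | zero => exact contMDiff_id
    | succ n ih => rw [Function.iterate_succ']; exact g.contMDiff.comp ih
  have hn : ∀ n : ℤ, ContMDiff (𝓡 (k + 1)) (𝓡 (k + 1)) 1
      (⇑((f.toEquiv : Equiv.Perm M) ^ n)) := by
    intro n
    obtain ⟨m, rfl | rfl⟩ := n.eq_nat_or_neg
    · rw [zpow_natCast]
      exact hiter f m
    · rw [zpow_neg, zpow_natCast, ← inv_pow]
      exact hiter f.symm m
  have hmeas : ∀ n : ℤ, Measurable fun x ↦ (1 / (n : ℝ)) * Real.log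
      ‖(mfderiv (𝓡 (k + 1)) (𝓡 (k + 1)) (⇑((f.toEquiv : Equiv.Perm M) ^ n)) x).comp
        (W.tangentLine x).subtypeL‖ := fun n ↦
    (W.measurable_norm_mfderiv_comp_tangentLine (hn n)).log.const_mul _
  have : (cofinite : Filter ℤ).IsCountablyGenerated := by
    rw [Int.cofinite_eq]
    infer_instance
  -- By uniqueness of limits this removes the quantifier over nonzero `l`; both sets on the right
  -- are convergence sets of countably many measurable functions.
  have heq : W.nonzeroExponentSet f.toEquiv = {x | ∃ l, W.HasLyapunovExponent f.toEquiv x l} \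
      {x | W.HasLyapunovExponent f.toEquiv x 0} := by
    ext x
    constructor
    · rintro ⟨l, hl, h0⟩
      exact ⟨⟨l, hl⟩, fun h ↦ h0 (tendsto_nhds_unique hl h)⟩
    · rintro ⟨⟨l, hl⟩, h⟩
      exact ⟨l, hl, fun h0 ↦ h (h0 ▸ hl)⟩
  rw [heq]
  exact (measurableSet_exists_tendsto hmeas).diff (measurableSet_tendsto (𝓝 0) hmeas)

end LineFoliation

/-! ### Conclusion. -/

theorem mainTheorem7 {k : ℕ} {M : Type*} [TopologicalSpace M] [T2Space M] [CompactSpace M]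
    [ConnectedSpace M] [ChartedSpace (EuclideanSpace ℝ (Fin (k + 1))) M]
    [IsManifold (𝓡 (k + 1)) ∞ M]
    [RiemannianBundle (fun x : M ↦ TangentSpace (𝓡 (k + 1)) x)]
    [IsContMDiffRiemannianBundle (𝓡 (k + 1)) ∞ (EuclideanSpace ℝ (Fin (k + 1)))
      (fun x : M ↦ TangentSpace (𝓡 (k + 1)) x)]
    {Mt : Type*} [TopologicalSpace Mt] [SimplyConnectedSpace Mt]
    (P : Mt → M) (hP : IsCoveringMap P)
    (x₀ : M) (hG : IsUnstretchable (FundamentalGroup M x₀))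
    (f : M ≃ₘ^1⟮𝓡 (k + 1), 𝓡 (k + 1)⟯ M)
    (W : LineFoliation k M) (hinv : W.IsInvariant f) (hqi : W.IsQuasiIsometric P) :
    W.IsLeafwiseNull (W.nonzeroExponentSet f.toEquiv) ∧
      (W.IsAbsolutelyContinuous →
        IsManifoldNull (k + 1) (W.nonzeroExponentSet f.toEquiv)) := by
  have : IsManifold (𝓡 (k + 1)) 1 M := IsManifold.of_le (n := ∞) (by simp)
  have : IsContinuousRiemannianBundle (EuclideanSpace ℝ (Fin (k + 1)))
      (fun x : M ↦ TangentSpace (𝓡 (k + 1)) x) := by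
    obtain ⟨g, hg, h⟩ := IsContMDiffRiemannianBundle.exists_contMDiff (IB := 𝓡 (k + 1)) (n := ∞)
      (F := EuclideanSpace ℝ (Fin (k + 1))) (E := fun x : M ↦ TangentSpace (𝓡 (k + 1)) x)
    exact ⟨g, hg.continuous, h⟩
  have : SecondCountableTopology M :=
    ChartedSpace.secondCountable_of_sigmaCompact (EuclideanSpace ℝ (Fin (k + 1))) M
  have hnull := hinv.isLeafwiseNull_nonzeroExponentSet hP hG hqi
  borelize M
  exact ⟨hnull, fun hac ↦ hac _ (W.measurableSet_nonzeroExponentSet f) hnull⟩
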